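/- Let $B_1$ be the open unit disc of $\mathbb{R}^2$, and let $\mathcal{H}$ be the completion of $C_c^\infty(B_1)$ under the norm $\big(\int_{B_1}\big(|\nabla \varphi|^2-\frac{\varphi^2}{(1-|x|^2)^2}\big)dx\big)^{1/2}$, regarded as a space of functions in $L^2(B_1)$: its elements are the $L^2(B_1)$-limits of sequences in $C_c^\infty(B_1)$ that are Cauchy for this norm. For every $\delta\in(0,4\pi)$ there is a constant $C$, depending only on $\delta$, with the following property. Let $u\in C^2(B_1)\cap\mathcal{H}$ (the membership in $\mathcal{H}$ expresses the boundary condition $u=0$ on $\partial B_1$) satisfy $$-\Delta u(x)-\frac{1}{(1-|x|^2)^2}\,u(x)=f(x)\qquad\text{for all } x\in B_1,$$ where $f\ge 0$, $f\in L^1(B_1)$ and $f\not\equiv 0$. Then $$\int_{B_1}\exp\left\{\frac{(4\pi-\delta)\,|u(x)|}{\|f\|_{L^1(B_1)}}\right\}dx\le C,$$ and in particular the integral is finite. -/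

import Mathlib

open Set Filter Topology MeasureTheory
open scoped Laplacian Gradient ContDiff

/-- The Euclidean plane. -/
abbrev Plane : Type := EuclideanSpace ℝ (Fin 2)

/-- The open unit disc `B₁` of the plane. -/
def unitDisc : Set Plane := Metric.ball 0 1

/-- `φ ∈ C_c^∞(B₁)`, as a function on the plane that vanishes outside a compact subset of `B₁`. -/
structure IsTestFunction (φ : Plane → ℝ) : Prop where
  smooth : ContDiff ℝ ∞ φ
  compact_support : HasCompactSupport φ
  support_subset : tsupport φ ⊆ unitDisc

/-- The Hardy energy `∫_{B₁} (|∇φ|² - φ² / (1 - |x|²)²) dx`; it is the square of the norm of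
`𝓗` on test functions. -/
noncomputable def hardyEnergy (φ : Plane → ℝ) : ℝ :=
  ∫ x in unitDisc, (‖∇ φ x‖ ^ 2 - φ x ^ 2 / (1 - ‖x‖ ^ 2) ^ 2)

/-- `u ∈ 𝓗`, where `𝓗` is the completion of `C_c^∞(B₁)` under the norm `(hardyEnergy φ)^{1/2}`.
Since this norm controls the `L²(B₁)` norm, the completion is a space of functions in `L²(B₁)`:
an element is the `L²` limit of a sequence of test functions which is Cauchy for the energy norm. -/
def MemHardySpace (u : Plane → ℝ) : Prop :=
  MemLp u 2 (volume.restrict unitDisc) ∧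
  ∃ φ : ℕ → Plane → ℝ,
    (∀ n, IsTestFunction (φ n)) ∧
    Tendsto (fun p : ℕ × ℕ => hardyEnergy (φ p.1 - φ p.2)) atTop (𝓝 0) ∧
    Tendsto (fun n => eLpNorm (φ n - u) 2 (volume.restrict unitDisc)) atTop (𝓝 0)

/-! Write `u = r v` with `r = (1 - |x|²)^{1/2}`, the ground state of the critical Hardy operator `L
= -Δ - (1 - |x|²)⁻²`. The energy becomes `∫ (1 - |x|²)|∇v|² + v²` (`hardyEnergy_eq`), and `L u = f`
becomes `v - div((1 - |x|²)∇v) = r f` (`wDiv_divRoot`). A `C²` element of the energy space has `∫ (1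
- |x|²)|∇v|² < ∞` by weak lower semicontinuity. The circle has zero capacity for the weight `1 -
|x|²` (`exists_cutoff_seq`), so integrations by parts against `v` leave no boundary term. This is
the only way in which the boundary condition enters. Testing with a bounded increasing function of
`v` gives `u ≥ 0` (`MemHardySpace.nonneg`).

The Green function of `L` is replaced by an explicit supersolution. Multiplied by `(1 - |x|²)²`, `L`
is invariant under automorphisms of the disc. With `z = (x - y)/(1 - x̄ y)`, the function `K = (1 -
|z|²)^{1/2} (1 - log|z| / (2π))` of `y` satisfies `L K ≥ δ_x`, and `0 ≤ K ≤ 1 + log(2/|x - y|) /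
(2π)`. Here `|z|² = |x - y|²/|1 - x̄ y|²` and `1 - |z|² = (1 - |x|²)(1 - |y|²)/|1 - x̄ y|²`. The
proof works with the smooth version in which `|x - y|²` is replaced by `|x - y|² + ε²` inside the
logarithm, so that `δ_x` becomes the approximate identity `ε²/(π(|x - y|² + ε²)²)`
(`le_compKernel_sub_wDiv`). Green's second identity then bounds a mollification of `u` at `x` by `∫
K f` (`integral_mollWeight_le`).

The rest is the Brezis–Merle argument. Jensen's inequality for the probability density `f/‖f‖₁`
bounds `exp(α u(x)/‖f‖₁)` by an average over `y` of `e^α (2/|x - y|)^{α/(2π)}`. Integrating in `x`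
and exchanging the integrals leaves the integral of `e^α (2/|z|)^{α/(2π)}` over a disc of radius 2,
which is finite exactly because `α = 4π - δ < 4π`. -/

/-! ### Calculus of partial derivatives. -/

/-- The `i`-th partial derivative of a function on the plane. -/
noncomputable def pd (i : Fin 2) (f : Plane → ℝ) (x : Plane) : ℝ :=
  fderiv ℝ f x (EuclideanSpace.single i 1)

/-- `f` is differentiable at `x` with `i`-th partial derivative `d`. -/
def HasPd (i : Fin 2) (f : Plane → ℝ) (d : ℝ) (x : Plane) : Prop :=
  DifferentiableAt ℝ f x ∧ pd i f x = d

namespace HasPd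

variable {i : Fin 2} {f g : Plane → ℝ} {c d : ℝ} {x : Plane}

theorem of_differentiableAt (hf : DifferentiableAt ℝ f x) : HasPd i f (pd i f x) x := ⟨hf, rfl⟩

theorem congr_deriv (hf : HasPd i f c x) (h : c = d) : HasPd i f d x := h ▸ hf

theorem congr_of_eventuallyEq (hf : HasPd i f c x) (h : g =ᶠ[𝓝 x] f) : HasPd i g c x :=
  ⟨hf.1.congr_of_eventuallyEq h, by rw [pd, h.fderiv_eq]; exact hf.2⟩

theorem const (a : ℝ) : HasPd i (fun _ => a) 0 x := by
  refine ⟨by fun_prop, by simp [pd]⟩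

theorem coord (j : Fin 2) : HasPd i (fun y : Plane => y j) (if j = i then 1 else 0) x := by
  refine ⟨by fun_prop, ?_⟩
  have : HasFDerivAt (fun y : Plane => y j) (EuclideanSpace.proj j : Plane →L[ℝ] ℝ) x :=
    (EuclideanSpace.proj j : Plane →L[ℝ] ℝ).hasFDerivAt
  rw [pd, this.fderiv]
  simp [eq_comm]

theorem add (hf : HasPd i f c x) (hg : HasPd i g d x) :
    HasPd i (fun y => f y + g y) (c + d) x := by
  refine ⟨hf.1.add hg.1, ?_⟩
  rw [pd, show (fun y => f y + g y) = f + g from rfl,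
    (hf.1.hasFDerivAt.add hg.1.hasFDerivAt).fderiv, ← hf.2, ← hg.2]; rfl

theorem sub (hf : HasPd i f c x) (hg : HasPd i g d x) :
    HasPd i (fun y => f y - g y) (c - d) x := by
  refine ⟨hf.1.sub hg.1, ?_⟩
  rw [pd, show (fun y => f y - g y) = f - g from rfl,
    (hf.1.hasFDerivAt.sub hg.1.hasFDerivAt).fderiv, ← hf.2, ← hg.2]; rfl

theorem mul (hf : HasPd i f c x) (hg : HasPd i g d x) :
    HasPd i (fun y => f y * g y) (c * g x + f x * d) x := by
  refine ⟨hf.1.mul hg.1, ?_⟩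
  rw [pd, show (fun y => f y * g y) = f * g from rfl,
    (hf.1.hasFDerivAt.mul hg.1.hasFDerivAt).fderiv, ← hf.2, ← hg.2]
  simp [pd]; ring

theorem comp {φ : ℝ → ℝ} {φ' : ℝ} (hφ : HasDerivAt φ φ' (f x)) (hf : HasPd i f c x) :
    HasPd i (fun y => φ (f y)) (φ' * c) x := by
  have := hφ.comp_hasFDerivAt x hf.1.hasFDerivAt
  refine ⟨this.differentiableAt, ?_⟩
  rw [pd, show (fun y => φ (f y)) = φ ∘ f from rfl, this.fderiv, ← hf.2]
  simp [pd]

theorem log (hf : HasPd i f c x) (h : f x ≠ 0) :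
    HasPd i (fun y => Real.log (f y)) ((f x)⁻¹ * c) x :=
  hf.comp (Real.hasDerivAt_log h)

theorem sqrt (hf : HasPd i f c x) (h : f x ≠ 0) :
    HasPd i (fun y => Real.sqrt (f y)) (1 / (2 * Real.sqrt (f x)) * c) x :=
  hf.comp (Real.hasDerivAt_sqrt h)

theorem inv (hf : HasPd i f c x) (h : f x ≠ 0) :
    HasPd i (fun y => (f y)⁻¹) (-(f x ^ 2)⁻¹ * c) x :=
  hf.comp (hasDerivAt_inv h)

end HasPd

/-! ### The disc, the weight `1 - |x|²` and its square root. -/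

theorem isOpen_unitDisc : IsOpen unitDisc := Metric.isOpen_ball

theorem measurableSet_unitDisc : MeasurableSet unitDisc := isOpen_unitDisc.measurableSet

theorem unitDisc_mem_nhds {x : Plane} (hx : x ∈ unitDisc) : unitDisc ∈ 𝓝 x :=
  isOpen_unitDisc.mem_nhds hx

theorem norm_sq_plane (x : Plane) : ‖x‖ ^ 2 = x 0 ^ 2 + x 1 ^ 2 := by
  simp [EuclideanSpace.norm_sq_eq, Fin.sum_univ_two]

/-- The defining function `1 - |x|²` of the unit disc. -/
noncomputable def disc (x : Plane) : ℝ := 1 - (x 0 ^ 2 + x 1 ^ 2)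

theorem disc_eq (x : Plane) : disc x = 1 - ‖x‖ ^ 2 := by rw [disc, norm_sq_plane]

theorem mem_unitDisc {x : Plane} : x ∈ unitDisc ↔ 0 < disc x := by
  rw [disc_eq, unitDisc, mem_ball_zero_iff]
  constructor
  · intro h; nlinarith [norm_nonneg x]
  · intro h; nlinarith [norm_nonneg x]

theorem contDiff_disc {n : WithTop ℕ∞} : ContDiff ℝ n disc := by unfold disc; fun_prop

theorem hasPd_disc (i : Fin 2) (x : Plane) : HasPd i disc (-(2 * x i)) x := by
  have := (HasPd.const (i := i) (x := x) 1).sub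
    (((HasPd.coord (i := i) (x := x) 0).mul (HasPd.coord 0)).add
      ((HasPd.coord (i := i) (x := x) 1).mul (HasPd.coord 1)))
  convert this.congr_deriv (d := -(2 * x i)) _ using 1
  · ext y; simp [disc]; ring
  · fin_cases i <;> simp <;> ring

/-- The supersolution `(1 - |x|²)^{1/2}`. -/
noncomputable def rootDisc (x : Plane) : ℝ := Real.sqrt (disc x)

theorem rootDisc_pos {x : Plane} (hx : x ∈ unitDisc) : 0 < rootDisc x :=
  Real.sqrt_pos.2 (mem_unitDisc.1 hx)

theorem rootDisc_sq {x : Plane} (hx : x ∈ unitDisc) : rootDisc x ^ 2 = disc x :=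
  Real.sq_sqrt (mem_unitDisc.1 hx).le

theorem continuous_rootDisc : Continuous rootDisc :=
  (contDiff_disc (n := 0)).continuous.sqrt

theorem hasPd_rootDisc (i : Fin 2) {x : Plane} (hx : x ∈ unitDisc) :
    HasPd i rootDisc (-(x i / rootDisc x)) x := by
  refine ((hasPd_disc i x).sqrt (mem_unitDisc.1 hx).ne').congr_deriv ?_
  have := rootDisc_pos hx
  change 1 / (2 * rootDisc x) * _ = _
  field_simp

theorem contDiffOn_rootDisc {n : WithTop ℕ∞} : ContDiffOn ℝ n rootDisc unitDisc := fun _ hx =>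
  (contDiff_disc.contDiffAt.sqrt (mem_unitDisc.1 hx).ne').contDiffWithinAt

theorem ContDiffOn.differentiableAt_disc {f : Plane → ℝ} {n : WithTop ℕ∞}
    (hf : ContDiffOn ℝ n f unitDisc) (hn : n ≠ 0) {x : Plane} (hx : x ∈ unitDisc) :
    DifferentiableAt ℝ f x :=
  (hf.contDiffAt (unitDisc_mem_nhds hx)).differentiableAt hn

theorem ContDiffOn.pd {f : Plane → ℝ} {n m : WithTop ℕ∞} {s : Set Plane} (hs : IsOpen s)
    (hf : ContDiffOn ℝ n f s) (hmn : m + 1 ≤ n) (i : Fin 2) :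
    ContDiffOn ℝ m (pd i f) s :=
  (hf.fderiv_of_isOpen hs hmn).clm_apply contDiffOn_const

theorem sum_pd_sq_eq_norm_gradient (f : Plane → ℝ) (x : Plane) :
    ‖∇ f x‖ ^ 2 = pd 0 f x ^ 2 + pd 1 f x ^ 2 := by
  have key : ∀ i, (∇ f x) i = pd i f x := fun i => by
    have h : inner ℝ (∇ f x) (EuclideanSpace.single i (1 : ℝ)) = pd i f x := by
      rw [pd, ← toDual_gradient, InnerProductSpace.toDual_apply_apply]
    rw [EuclideanSpace.inner_single_right] at h
    simpa using h
  rw [norm_sq_plane, key, key]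

theorem laplacian_eq_pd {u : Plane → ℝ} {x : Plane} (hu : ContDiffAt ℝ 2 u x) :
    Δ u x = pd 0 (pd 0 u) x + pd 1 (pd 1 u) x := by
  rw [InnerProductSpace.laplacian_eq_iteratedFDeriv_orthonormalBasis u
    (EuclideanSpace.basisFun (Fin 2) ℝ)]
  have hd : DifferentiableAt ℝ (fderiv ℝ u) x :=
    (hu.fderiv_right (m := 1) (by norm_num)).differentiableAt (by norm_num)
  have key : ∀ i : Fin 2, iteratedFDeriv ℝ 2 u x
      ![EuclideanSpace.basisFun (Fin 2) ℝ i, EuclideanSpace.basisFun (Fin 2) ℝ i] =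
      pd i (pd i u) x := fun i => by
    rw [iteratedFDeriv_two_apply]
    have := hd.hasFDerivAt.clm_apply
      (hasFDerivAt_const (EuclideanSpace.single i (1 : ℝ) : Plane) x)
    unfold pd
    rw [this.fderiv]
    simp
  simp only [Fin.sum_univ_two, key]

/-! ### Cutoffs and integration by parts. -/

/-- A `C¹` function on the plane with compact support in the unit disc. -/
structure IsCutoff (ζ : Plane → ℝ) : Prop where
  contDiff : ContDiff ℝ 1 ζ
  compact : HasCompactSupport ζ
  subset : tsupport ζ ⊆ unitDisc

theorem continuous_mul_of_tsupport {ζ F : Plane → ℝ} (hζ : Continuous ζ)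
    (hs : tsupport ζ ⊆ unitDisc) (hF : ContinuousOn F unitDisc) :
    Continuous (fun x => ζ x * F x) := by
  rw [continuous_iff_continuousAt]
  intro x
  by_cases hx : x ∈ tsupport ζ
  · exact hζ.continuousAt.mul (hF.continuousAt (unitDisc_mem_nhds (hs hx)))
  · have : (fun x => ζ x * F x) =ᶠ[𝓝 x] fun _ => 0 := by
      filter_upwards [notMem_tsupport_iff_eventuallyEq.1 hx] with y hy
      simp [hy]
    exact this.continuousAt

theorem integrable_of_continuousOn_tsupport {ζ F : Plane → ℝ} (hζ : Continuous ζ)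
    (hc : HasCompactSupport ζ) (hs : tsupport ζ ⊆ unitDisc) (hF : ContinuousOn F unitDisc) :
    Integrable (fun x => ζ x * F x) :=
  (continuous_mul_of_tsupport hζ hs hF).integrable_of_hasCompactSupport hc.mul_right

theorem setIntegral_unitDisc_eq {ζ F : Plane → ℝ} (hs : tsupport ζ ⊆ unitDisc) :
    ∫ x in unitDisc, ζ x * F x = ∫ x, ζ x * F x := by
  apply setIntegral_eq_integral_of_forall_compl_eq_zero
  intro x hx
  rw [image_eq_zero_of_notMem_tsupport (fun h => hx (hs h)), zero_mul]

namespace IsCutoff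

variable {ζ F : Plane → ℝ}

theorem integrableOn_mul (hζ : IsCutoff ζ) (hF : ContinuousOn F unitDisc) :
    IntegrableOn (fun x => ζ x * F x) unitDisc :=
  (integrable_of_continuousOn_tsupport hζ.contDiff.continuous hζ.compact hζ.subset hF).integrableOn

theorem tsupport_pd_subset (ζ : Plane → ℝ) (i : Fin 2) : tsupport (pd i ζ) ⊆ tsupport ζ := by
  refine closure_minimal (fun x hx => ?_) (isClosed_tsupport ζ)
  by_contra h
  apply hx
  have := (notMem_tsupport_iff_eventuallyEq.1 h).fderiv_eq (𝕜 := ℝ)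
  simp [pd, this]

theorem continuous_pd (hζ : IsCutoff ζ) (i : Fin 2) : Continuous (pd i ζ) :=
  (hζ.contDiff.continuous_fderiv (by norm_num)).clm_apply continuous_const

theorem compact_pd (hζ : IsCutoff ζ) (i : Fin 2) : HasCompactSupport (pd i ζ) :=
  hζ.compact.mono' ((subset_tsupport _).trans (tsupport_pd_subset ζ i))

theorem integrableOn_pd_mul (hζ : IsCutoff ζ) (hF : ContinuousOn F unitDisc) (i : Fin 2) :
    IntegrableOn (fun x => pd i ζ x * F x) unitDisc :=
  (integrable_of_continuousOn_tsupport (hζ.continuous_pd i) (hζ.compact_pd i)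
    ((tsupport_pd_subset ζ i).trans hζ.subset) hF).integrableOn

/-- Integration by parts against a cutoff. -/
theorem integral_pd_mul (hζ : IsCutoff ζ) (hF : ContDiffOn ℝ 1 F unitDisc) (i : Fin 2) :
    ∫ x in unitDisc, pd i ζ x * F x = -∫ x in unitDisc, ζ x * pd i F x := by
  have hF' : ContinuousOn (pd i F) unitDisc :=
    (hF.pd (m := 0) isOpen_unitDisc (by norm_num) i).continuousOn
  rw [setIntegral_unitDisc_eq ((tsupport_pd_subset ζ i).trans hζ.subset),
    setIntegral_unitDisc_eq hζ.subset]
  have h1 := integrable_of_continuousOn_tsupport (hζ.continuous_pd i) (hζ.compact_pd i)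
    ((tsupport_pd_subset ζ i).trans hζ.subset) hF.continuousOn
  have h2 := integrable_of_continuousOn_tsupport hζ.contDiff.continuous hζ.compact hζ.subset hF'
  have h3 := integrable_of_continuousOn_tsupport hζ.contDiff.continuous hζ.compact hζ.subset
    hF.continuousOn
  have := integral_mul_fderiv_eq_neg_fderiv_mul_of_integrable (f := ζ) (g := F)
    (v := EuclideanSpace.single i 1) (μ := volume) h1 h2 h3
    (fun x _ => hζ.contDiff.differentiable (by norm_num) x)
    (fun x hx => hF.differentiableAt_disc (by norm_num) (hζ.subset hx))
  unfold pd
  rw [this, neg_neg]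

theorem of_isTestFunction {φ : Plane → ℝ} (h : IsTestFunction φ) : IsCutoff φ :=
  ⟨h.smooth.of_le (by exact_mod_cast le_top), h.compact_support, h.support_subset⟩

theorem mul_contDiffOn (hζ : IsCutoff ζ) (hF : ContDiffOn ℝ 1 F unitDisc) :
    IsCutoff (fun x => ζ x * F x) := by
  have hsub : tsupport (fun x => ζ x * F x) ⊆ tsupport ζ := tsupport_mul_subset_left
  refine ⟨?_, hζ.compact.mul_right, hsub.trans hζ.subset⟩
  rw [contDiff_iff_contDiffAt]
  intro x
  by_cases hx : x ∈ tsupport ζ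
  · exact hζ.contDiff.contDiffAt.mul (hF.contDiffAt (unitDisc_mem_nhds (hζ.subset hx)))
  · have : (fun x => ζ x * F x) =ᶠ[𝓝 x] fun _ => 0 := by
      filter_upwards [notMem_tsupport_iff_eventuallyEq.1 hx] with y hy
      simp [hy]
    exact contDiffAt_const.congr_of_eventuallyEq this

end IsCutoff

/-! ### Logarithmic cutoffs and zero capacity of the circle. -/

/-- A smooth step that vanishes below `exp (-2N)` and equals `1` above `exp (-N)`. -/
noncomputable def logStep (N s : ℝ) : ℝ :=
  if s ≤ 0 then 0 else Real.smoothTransition (2 + Real.log s / N)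

theorem logStep_nonneg (N s : ℝ) : 0 ≤ logStep N s := by
  unfold logStep; split_ifs
  · exact le_rfl
  · exact Real.smoothTransition.nonneg _

theorem logStep_le_one (N s : ℝ) : logStep N s ≤ 1 := by
  unfold logStep; split_ifs
  · exact zero_le_one
  · exact Real.smoothTransition.le_one _

theorem logStep_eq_zero {N s : ℝ} (hN : 0 < N) (hs : s ≤ Real.exp (-(2 * N))) :
    logStep N s = 0 := by
  unfold logStep; split_ifs with h
  · rfl
  · push Not at h
    apply Real.smoothTransition.zero_of_nonpos
    have : Real.log s ≤ -(2 * N) := by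
      rw [← Real.log_exp (-(2 * N))]; exact Real.log_le_log h hs
    have : Real.log s / N ≤ -2 := by rw [div_le_iff₀ hN]; linarith
    linarith

theorem logStep_eq_one {N s : ℝ} (hN : 0 < N) (hs : Real.exp (-N) ≤ s) : logStep N s = 1 := by
  have h : 0 < s := (Real.exp_pos _).trans_le hs
  rw [logStep, if_neg h.not_ge]
  apply Real.smoothTransition.one_of_one_le
  have : -N ≤ Real.log s := by
    rw [← Real.log_exp (-N)]; exact Real.log_le_log (Real.exp_pos _) hs
  have : -1 ≤ Real.log s / N := by rw [le_div_iff₀ hN]; linarith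
  linarith

theorem logStep_eventuallyEq_of_pos {N s : ℝ} (hs : 0 < s) :
    logStep N =ᶠ[𝓝 s] fun s => Real.smoothTransition (2 + Real.log s / N) := by
  filter_upwards [lt_mem_nhds hs] with t ht
  rw [logStep, if_neg ht.not_ge]

theorem logStep_eventuallyEq_zero {N s : ℝ} (hN : 0 < N) (hs : s < Real.exp (-(2 * N))) :
    logStep N =ᶠ[𝓝 s] fun _ => 0 := by
  filter_upwards [gt_mem_nhds hs] with t ht
  exact logStep_eq_zero hN (le_of_lt ht)

theorem contDiff_logStep {N : ℝ} (hN : 0 < N) : ContDiff ℝ 1 (logStep N) := by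
  rw [contDiff_iff_contDiffAt]
  intro s
  rcases le_or_gt s 0 with hs | hs
  · exact contDiffAt_const.congr_of_eventuallyEq
      (logStep_eventuallyEq_zero hN (hs.trans_lt (Real.exp_pos _)))
  · refine ContDiffAt.congr_of_eventuallyEq ?_ (logStep_eventuallyEq_of_pos hs)
    refine (Real.smoothTransition.contDiffAt (n := 1)).comp s ?_
    exact contDiffAt_const.add ((Real.contDiffAt_log.2 hs.ne').div_const _)

theorem exists_deriv_smoothTransition_le :
    ∃ C : ℝ, 0 ≤ C ∧ ∀ t, |deriv Real.smoothTransition t| ≤ C := by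
  have hc : Continuous (deriv Real.smoothTransition) :=
    (Real.smoothTransition.contDiff (n := 1)).continuous_deriv (by norm_num)
  obtain ⟨C, hC⟩ := (isCompact_Icc (a := (0 : ℝ)) (b := 1)).exists_bound_of_continuousOn
    hc.continuousOn
  refine ⟨max C 0, le_max_right _ _, fun t => ?_⟩
  by_cases ht : t ∈ Icc (0 : ℝ) 1
  · exact (hC t ht).trans (le_max_left _ _)
  · have : deriv Real.smoothTransition t = 0 := by
      rcases lt_or_ge t 0 with h | h
      · have : Real.smoothTransition =ᶠ[𝓝 t] fun _ => 0 := by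
          filter_upwards [gt_mem_nhds h] with s hs
          exact Real.smoothTransition.zero_of_nonpos (le_of_lt hs)
        rw [this.deriv_eq]; simp
      · have h1 : 1 < t := by by_contra h1; exact ht ⟨h, not_lt.1 h1⟩
        have : Real.smoothTransition =ᶠ[𝓝 t] fun _ => 1 := by
          filter_upwards [lt_mem_nhds h1] with s hs
          exact Real.smoothTransition.one_of_one_le (le_of_lt hs)
        rw [this.deriv_eq]; simp
    rw [this]; simp

theorem abs_deriv_logStep_le {C N s : ℝ} (hC : ∀ t, |deriv Real.smoothTransition t| ≤ C)
    (hN : 0 < N) (hs : 0 < s) : |deriv (logStep N) s| ≤ C / (N * s) := by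
  have h1 : HasDerivAt (fun s => 2 + Real.log s / N) (s⁻¹ / N) s :=
    ((Real.hasDerivAt_log hs.ne').div_const N).const_add 2
  have h2 : HasDerivAt Real.smoothTransition (deriv Real.smoothTransition (2 + Real.log s / N))
      (2 + Real.log s / N) :=
    ((Real.smoothTransition.contDiff (n := 1)).differentiable (by norm_num) _).hasDerivAt
  have h3 : HasDerivAt (fun s => Real.smoothTransition (2 + Real.log s / N))
      (deriv Real.smoothTransition (2 + Real.log s / N) * (s⁻¹ / N)) s :=
    HasDerivAt.comp (h₂ := Real.smoothTransition) s h2 h1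
  rw [(logStep_eventuallyEq_of_pos hs).deriv_eq, h3.deriv, abs_mul,
    abs_of_pos (show 0 < s⁻¹ / N by positivity)]
  calc _ ≤ C * (s⁻¹ / N) := mul_le_mul_of_nonneg_right (hC _) (by positivity)
    _ = _ := by field_simp

/-- The logarithmic cutoff of the disc, adapted to the weight `1 - |x|²`. -/
noncomputable def logCutoff (N : ℝ) (x : Plane) : ℝ := logStep N (disc x)

theorem isCutoff_logCutoff {N : ℝ} (hN : 0 < N) : IsCutoff (logCutoff N) := by
  have hcl : IsClosed {x : Plane | Real.exp (-(2 * N)) ≤ disc x} :=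
    isClosed_le continuous_const (contDiff_disc (n := 0)).continuous
  have hsub : tsupport (logCutoff N) ⊆ {x : Plane | Real.exp (-(2 * N)) ≤ disc x} := by
    refine closure_minimal (fun x hx => ?_) hcl
    by_contra h
    exact hx (logStep_eq_zero hN (not_le.1 h).le)
  have hdisc : {x : Plane | Real.exp (-(2 * N)) ≤ disc x} ⊆ unitDisc := fun x hx =>
    mem_unitDisc.2 ((Real.exp_pos _).trans_le hx)
  refine ⟨(contDiff_logStep hN).comp contDiff_disc, ?_, hsub.trans hdisc⟩
  exact (isCompact_closedBall (0 : Plane) 1).of_isClosed_subset (isClosed_tsupport _)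
    ((hsub.trans hdisc).trans Metric.ball_subset_closedBall)

theorem hasPd_logCutoff {N : ℝ} (hN : 0 < N) (i : Fin 2) (x : Plane) :
    HasPd i (logCutoff N) (deriv (logStep N) (disc x) * -(2 * x i)) x :=
  (hasPd_disc i x).comp (((contDiff_logStep hN).differentiable (by norm_num) _).hasDerivAt)

theorem integral_ball_inv_disc {R : ℝ} (hR0 : 0 ≤ R) (hR : R < 1) :
    IntegrableOn (fun x : Plane => (1 - ‖x‖ ^ 2)⁻¹) (Metric.closedBall 0 R) ∧
    ∫ x in Metric.closedBall (0 : Plane) R, (1 - ‖x‖ ^ 2)⁻¹ =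
      -(Real.pi * Real.log (1 - R ^ 2)) := by
  have hpos : ∀ r ∈ Icc 0 R, 0 < 1 - r ^ 2 := fun r hr => by nlinarith [hr.1, hr.2]
  constructor
  · refine ContinuousOn.integrableOn_compact (isCompact_closedBall _ _) ?_
    refine ContinuousOn.inv₀ (by fun_prop) fun x hx => ?_
    exact (hpos _ ⟨norm_nonneg _, mem_closedBall_zero_iff.1 hx⟩).ne'
  · rw [← integral_indicator Metric.isClosed_closedBall.measurableSet]
    have h1 : (Metric.closedBall (0 : Plane) R).indicator (fun x => (1 - ‖x‖ ^ 2)⁻¹) =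
        fun x => (Iic R).indicator (fun r : ℝ => (1 - r ^ 2)⁻¹) ‖x‖ := by
      ext x
      by_cases hx : ‖x‖ ≤ R <;> simp [indicator, hx]
    rw [h1, integral_fun_norm_addHaar volume ((Iic R).indicator (fun r : ℝ => (1 - r ^ 2)⁻¹))]
    have h2 : ∫ y in Ioi (0 : ℝ), y ^ (Module.finrank ℝ Plane - 1) •
        (Iic R).indicator (fun r : ℝ => (1 - r ^ 2)⁻¹) y = ∫ y in (0 : ℝ)..R, y * (1 - y ^ 2)⁻¹ := by
      rw [intervalIntegral.integral_of_le hR0, ← Ioi_inter_Iic,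
        ← setIntegral_indicator measurableSet_Iic]
      congr 1; ext y
      by_cases hy : y ≤ R <;> simp [indicator, hy]
    have h3 : ∫ y in (0 : ℝ)..R, y * (1 - y ^ 2)⁻¹ = -(Real.log (1 - R ^ 2) / 2) := by
      have hd : ∀ y ∈ uIcc 0 R, HasDerivAt (fun y => -(Real.log (1 - y ^ 2) / 2))
          (y * (1 - y ^ 2)⁻¹) y := fun y hy => by
        rw [uIcc_of_le hR0] at hy
        have hp := hpos y hy
        refine ((((hasDerivAt_pow 2 y).const_sub 1).log hp.ne').div_const 2).neg.congr_deriv ?_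
        field_simp; norm_num; ring
      rw [intervalIntegral.integral_eq_sub_of_hasDerivAt hd]
      · simp
      · apply ContinuousOn.intervalIntegrable
        rw [uIcc_of_le hR0]
        exact continuousOn_id.mul (ContinuousOn.inv₀ (by fun_prop) fun y hy => (hpos y hy).ne')
    rw [h2, h3, Measure.real, EuclideanSpace.volume_ball_fin_two]
    simp [Real.pi_pos.le]; ring

/-- The slope bound `C / (N s)` makes the density at most `4 C² / N²` times `(1 - |x|²)⁻¹`, and it
vanishes where `1 - |x|² < exp (-2N)`. On the remaining disc `(1 - |x|²)⁻¹` has integral `2πN`, so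
one factor `N` survives in the denominator. -/
theorem integral_logCutoff_energy_le {C N : ℝ} (hC : ∀ t, |deriv Real.smoothTransition t| ≤ C)
    (hN : 0 < N) :
    ∫ x in unitDisc, disc x * (pd 0 (logCutoff N) x ^ 2 + pd 1 (logCutoff N) x ^ 2) ≤
      8 * Real.pi * C ^ 2 / N := by
  have hE : Real.exp (-(2 * N)) < 1 := by rw [Real.exp_lt_one_iff]; linarith
  have hE0 := Real.exp_pos (-(2 * N))
  -- The radius at which `1 - |x|² = exp (-2N)`; outside it the cutoff is locally zero.
  set R := Real.sqrt (1 - Real.exp (-(2 * N))) with hRdef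
  have hRsq : R ^ 2 = 1 - Real.exp (-(2 * N)) := Real.sq_sqrt (by linarith)
  have hR0 : 0 ≤ R := Real.sqrt_nonneg _
  have hR1 : R < 1 := by nlinarith
  obtain ⟨hint, hval⟩ := integral_ball_inv_disc hR0 hR1
  have hsubset : Metric.closedBall (0 : Plane) R ⊆ unitDisc :=
    Metric.closedBall_subset_ball hR1
  calc _ ≤ ∫ x in unitDisc, (Metric.closedBall (0 : Plane) R).indicator
        (fun x => 4 * C ^ 2 / N ^ 2 * (1 - ‖x‖ ^ 2)⁻¹) x := by
        refine integral_mono_of_nonneg ?_ ?_ ?_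
        · filter_upwards [ae_restrict_mem measurableSet_unitDisc] with x hx
          exact mul_nonneg (mem_unitDisc.1 hx).le (by positivity)
        · exact ((integrable_indicator_iff Metric.isClosed_closedBall.measurableSet).2
            (hint.const_mul _)).integrableOn
        · filter_upwards [ae_restrict_mem measurableSet_unitDisc] with x hx
          have ha := mem_unitDisc.1 hx
          simp only [(hasPd_logCutoff hN _ x).2]
          by_cases hxR : ‖x‖ ≤ R
          · rw [indicator_of_mem (mem_closedBall_zero_iff.2 hxR), ← disc_eq]
            have hb := abs_deriv_logStep_le hC hN ha
            have hb2 : deriv (logStep N) (disc x) ^ 2 ≤ (C / (N * disc x)) ^ 2 :=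
              sq_le_sq' (by linarith [abs_le.1 hb]) (abs_le.1 hb).2
            have hx1 : x 0 ^ 2 + x 1 ^ 2 ≤ 1 := by unfold disc at ha; linarith
            calc _ = deriv (logStep N) (disc x) ^ 2 * (4 * (x 0 ^ 2 + x 1 ^ 2) * disc x) := by ring
              _ ≤ (C / (N * disc x)) ^ 2 * (4 * 1 * disc x) := by gcongr
              _ = _ := by field_simp
          · rw [indicator_of_notMem (by simpa using hxR)]
            have : disc x < Real.exp (-(2 * N)) := by
              rw [disc_eq]
              have : R ^ 2 < ‖x‖ ^ 2 := by gcongr; exact not_le.1 hxR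
              linarith
            rw [(logStep_eventuallyEq_zero hN this).deriv_eq]
            simp
    _ = 4 * C ^ 2 / N ^ 2 * (2 * N * Real.pi) := by
        rw [setIntegral_indicator Metric.isClosed_closedBall.measurableSet,
          inter_eq_self_of_subset_right hsubset, integral_const_mul, hval, hRsq]
        simp; left; ring
    _ = _ := by field_simp; ring

/-- The boundary of the disc has zero capacity for the weight `1 - |x|²`. -/
theorem exists_cutoff_seq : ∃ χ : ℕ → Plane → ℝ, (∀ n, IsCutoff (χ n)) ∧
    (∀ n x, 0 ≤ χ n x) ∧ (∀ n x, χ n x ≤ 1) ∧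
    (∀ x ∈ unitDisc, ∀ᶠ n in atTop, χ n x = 1) ∧
    Tendsto (fun n => ∫ x in unitDisc, disc x * (pd 0 (χ n) x ^ 2 + pd 1 (χ n) x ^ 2))
      atTop (𝓝 0) := by
  obtain ⟨C, -, hC⟩ := exists_deriv_smoothTransition_le
  have hpos : ∀ n : ℕ, (0 : ℝ) < n + 1 := fun n => by positivity
  refine ⟨fun n => logCutoff (n + 1), fun n => isCutoff_logCutoff (hpos n),
    fun n x => logStep_nonneg _ _, fun n x => logStep_le_one _ _, fun x hx => ?_, ?_⟩
  · have h : Tendsto (fun n : ℕ => Real.exp (-((n : ℝ) + 1))) atTop (𝓝 0) :=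
      Real.tendsto_exp_neg_atTop_nhds_zero.comp
        (tendsto_atTop_add_const_right _ _ tendsto_natCast_atTop_atTop)
    filter_upwards [h.eventually (gt_mem_nhds (mem_unitDisc.1 hx))] with n hn
    exact logStep_eq_one (hpos n) (le_of_lt hn)
  · refine squeeze_zero (fun n => ?_) (fun n => integral_logCutoff_energy_le hC (hpos n)) ?_
    · exact setIntegral_nonneg measurableSet_unitDisc fun x hx =>
        mul_nonneg (mem_unitDisc.1 hx).le (by positivity)
    · exact tendsto_const_nhds.div_atTop
        (tendsto_atTop_add_const_right _ _ tendsto_natCast_atTop_atTop)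

/-! ### Ground state substitution and the energy. -/

/-- The weighted energy density `(1 - |x|²) |∇w|²`. -/
noncomputable def wDens (w : Plane → ℝ) (x : Plane) : ℝ :=
  disc x * (pd 0 w x ^ 2 + pd 1 w x ^ 2)

/-- The quotient by the supersolution `(1 - |x|²)^{1/2}`. -/
noncomputable def divRoot (u : Plane → ℝ) (x : Plane) : ℝ := u x * (rootDisc x)⁻¹

theorem contDiffOn_rootDisc_inv {n : WithTop ℕ∞} :
    ContDiffOn ℝ n (fun x => (rootDisc x)⁻¹) unitDisc :=
  contDiffOn_rootDisc.inv fun _ hx => (rootDisc_pos hx).ne'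

theorem contDiffOn_divRoot {u : Plane → ℝ} {n : WithTop ℕ∞} (hu : ContDiffOn ℝ n u unitDisc) :
    ContDiffOn ℝ n (divRoot u) unitDisc := hu.mul contDiffOn_rootDisc_inv

theorem isCutoff_divRoot {φ : Plane → ℝ} (hφ : IsTestFunction φ) : IsCutoff (divRoot φ) :=
  (IsCutoff.of_isTestFunction hφ).mul_contDiffOn contDiffOn_rootDisc_inv

theorem eq_rootDisc_mul_divRoot (u : Plane → ℝ) {x : Plane} (hx : x ∈ unitDisc) :
    u x = rootDisc x * divRoot u x := by
  have := (rootDisc_pos hx).ne'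
  unfold divRoot; field_simp

theorem hasPd_of_divRoot {u : Plane → ℝ} (hu : ContDiffOn ℝ 1 u unitDisc) (i : Fin 2) {x : Plane}
    (hx : x ∈ unitDisc) :
    HasPd i u (-(x i / rootDisc x) * divRoot u x + rootDisc x * pd i (divRoot u) x) x := by
  refine ((hasPd_rootDisc i hx).mul (HasPd.of_differentiableAt
    ((contDiffOn_divRoot hu).differentiableAt_disc (by norm_num) hx))).congr_of_eventuallyEq ?_
  filter_upwards [unitDisc_mem_nhds hx] with y hy using eq_rootDisc_mul_divRoot u hy

theorem IsCutoff.continuousOn_wDens {w : Plane → ℝ} (hw : IsCutoff w) :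
    Continuous (wDens w) :=
  (contDiff_disc (n := 0)).continuous.mul
    (((hw.continuous_pd 0).pow 2).add ((hw.continuous_pd 1).pow 2))

theorem IsCutoff.integrableOn_wDens {w : Plane → ℝ} (hw : IsCutoff w) :
    IntegrableOn (wDens w) unitDisc := by
  have h : ∀ i, IntegrableOn (fun x => pd i w x * (disc x * pd i w x)) unitDisc := fun i =>
    hw.integrableOn_pd_mul (((contDiff_disc (n := 0)).continuous.mul
      (hw.continuous_pd i)).continuousOn) i
  refine ((h 0).add (h 1)).congr (.of_forall fun x => ?_)
  simp [wDens]; ring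

theorem IsCutoff.integrableOn_sq {w : Plane → ℝ} (hw : IsCutoff w) :
    IntegrableOn (fun x => w x ^ 2) unitDisc := by
  refine (hw.integrableOn_mul hw.contDiff.continuous.continuousOn).congr (.of_forall fun x => ?_)
  simp; ring

/-- The ground state representation of the Hardy energy. -/
theorem hardyEnergy_eq {φ : Plane → ℝ} (hφ : IsTestFunction φ) :
    hardyEnergy φ = ∫ x in unitDisc, (wDens (divRoot φ) x + divRoot φ x ^ 2) := by
  set w := divRoot φ with hw
  have hc : IsCutoff w := isCutoff_divRoot hφ
  have hc2 : IsCutoff (fun x => w x * w x) := hc.mul_contDiffOn hc.contDiff.contDiffOn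
  have hco : ∀ i : Fin 2, ContDiff ℝ 1 (fun x : Plane => x i) := fun i => by fun_prop
  -- Since `r ∇r = -x`, expanding `|∇(r w)|²` produces the cross term `-x · ∇(w²)`, whose integral
  -- is `2 ∫ w²` because `div x = 2`. The zero-order terms add up to `(|x|² - 1) w² / (1 - |x|²) =
  -- -w²`, so one `∫ w²` is left.
  have key : ∀ i : Fin 2, ∫ x in unitDisc, pd i (fun x => w x * w x) x * x i =
      -∫ x in unitDisc, w x ^ 2 := fun i => by
    rw [hc2.integral_pd_mul (hco i).contDiffOn]
    congr 2; ext x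
    rw [(HasPd.coord i).2]; simp; ring
  have hi : ∀ i : Fin 2, IntegrableOn (fun x => pd i (fun x => w x * w x) x * x i) unitDisc :=
    fun i => hc2.integrableOn_pd_mul (hco i).continuous.continuousOn i
  have hpt : hardyEnergy φ = ∫ x in unitDisc, (wDens w x - (pd 0 (fun x => w x * w x) x * x 0 +
      pd 1 (fun x => w x * w x) x * x 1) - w x ^ 2) := by
    refine setIntegral_congr_fun measurableSet_unitDisc fun x hx => ?_
    have hwd : ∀ i, HasPd i w (pd i w x) x := fun i =>
      .of_differentiableAt (hc.contDiff.differentiable (by norm_num) x)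
    simp only [sum_pd_sq_eq_norm_gradient, ← disc_eq, wDens,
      ((hwd _).mul (hwd _)).2,
      (hasPd_of_divRoot (hφ.smooth.of_le (by exact_mod_cast le_top)).contDiffOn _ hx).2, ← hw]
    have hr := rootDisc_pos hx
    rw [eq_rootDisc_mul_divRoot φ hx, ← hw, ← rootDisc_sq hx]
    have hx2 : x 0 ^ 2 = 1 - rootDisc x ^ 2 - x 1 ^ 2 := by
      rw [rootDisc_sq hx, disc]; ring
    field_simp
    linear_combination (w x) ^ 2 * hx2
  have hs : IntegrableOn (fun x => pd 0 (fun x => w x * w x) x * x 0 +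
      pd 1 (fun x => w x * w x) x * x 1) unitDisc := (hi 0).add (hi 1)
  have ht : IntegrableOn (fun x => wDens w x - (pd 0 (fun x => w x * w x) x * x 0 +
      pd 1 (fun x => w x * w x) x * x 1)) unitDisc := hc.integrableOn_wDens.sub hs
  rw [hpt, integral_sub ht hc.integrableOn_sq,
    integral_sub hc.integrableOn_wDens hs, integral_add (hi 0) (hi 1), key, key,
    integral_add hc.integrableOn_wDens hc.integrableOn_sq]
  ring

theorem divRoot_sub (φ ψ : Plane → ℝ) (x : Plane) :
    divRoot (φ - ψ) x = divRoot φ x - divRoot ψ x := by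
  simp [divRoot]; ring

theorem IsTestFunction.sub {φ ψ : Plane → ℝ} (hφ : IsTestFunction φ) (hψ : IsTestFunction ψ) :
    IsTestFunction (φ - ψ) :=
  ⟨hφ.smooth.sub hψ.smooth, hφ.compact_support.sub hψ.compact_support,
    (tsupport_sub φ ψ).trans (union_subset hφ.support_subset hψ.support_subset)⟩

/-- Pointwise `2(a - b)² + 2b² - a² = (a - 2b)²`. The ground state form is needed because the
original Hardy density is not pointwise nonnegative. -/
theorem hardyEnergy_le_two_mul {φ ψ : Plane → ℝ} (hφ : IsTestFunction φ) (hψ : IsTestFunction ψ) :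
    hardyEnergy φ ≤ 2 * hardyEnergy (φ - ψ) + 2 * hardyEnergy ψ := by
  have hd := hφ.sub hψ
  have hint : ∀ {ρ : Plane → ℝ}, IsTestFunction ρ →
      IntegrableOn (fun x => wDens (divRoot ρ) x + divRoot ρ x ^ 2) unitDisc := fun h =>
    (isCutoff_divRoot h).integrableOn_wDens.add (isCutoff_divRoot h).integrableOn_sq
  rw [hardyEnergy_eq hφ, hardyEnergy_eq hψ, hardyEnergy_eq hd, ← integral_const_mul,
    ← integral_const_mul, ← integral_add ((hint hd).const_mul 2) ((hint hψ).const_mul 2)]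
  refine setIntegral_mono_on (hint hφ) (((hint hd).const_mul 2).add ((hint hψ).const_mul 2))
    measurableSet_unitDisc fun x hx => ?_
  have hpd : ∀ i, pd i (divRoot (φ - ψ)) x = pd i (divRoot φ) x - pd i (divRoot ψ) x := fun i => by
    rw [show divRoot (φ - ψ) = fun y => divRoot φ y - divRoot ψ y from
      funext (divRoot_sub φ ψ)]
    exact ((HasPd.of_differentiableAt
      ((isCutoff_divRoot hφ).contDiff.differentiable (by norm_num) x)).sub
      (.of_differentiableAt ((isCutoff_divRoot hψ).contDiff.differentiable (by norm_num) x))).2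
  simp only [wDens, hpd, divRoot_sub]
  have ha := (mem_unitDisc.1 hx).le
  nlinarith [mul_nonneg ha (sq_nonneg (pd 0 (divRoot φ) x - 2 * pd 0 (divRoot ψ) x)),
    mul_nonneg ha (sq_nonneg (pd 1 (divRoot φ) x - 2 * pd 1 (divRoot ψ) x)),
    sq_nonneg (divRoot φ x - 2 * divRoot ψ x)]

/-- A Cauchy sequence is bounded: beyond some index every energy is within the quasi-triangle
inequality of a fixed one. The nonnegative term `∫ w²` is dropped from the energy. -/
theorem MemHardySpace.exists_seq {u : Plane → ℝ} (hu : MemHardySpace u) :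
    ∃ (M : ℝ) (φ : ℕ → Plane → ℝ), (∀ n, IsTestFunction (φ n)) ∧
      (∀ n, ∫ x in unitDisc, wDens (divRoot (φ n)) x ≤ M) ∧
      Tendsto (fun n => eLpNorm (φ n - u) 2 (volume.restrict unitDisc)) atTop (𝓝 0) := by
  obtain ⟨-, φ, hφ, hE, hL⟩ := hu
  have h1 := hE.eventually (gt_mem_nhds zero_lt_one)
  obtain ⟨⟨N, N'⟩, hN⟩ := eventually_atTop.1 h1
  refine ⟨2 + 2 * hardyEnergy (φ (max N N')), fun n => φ (n + max N N'), fun n => hφ _,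
    fun n => ?_, hL.comp (tendsto_add_atTop_nat _)⟩
  have h2 := hN (n + max N N', max N N') ⟨by dsimp; omega, by dsimp; omega⟩
  have h3 := hardyEnergy_le_two_mul (hφ (n + max N N')) (hφ (max N N'))
  have h4 : ∫ x in unitDisc, wDens (divRoot (φ (n + max N N'))) x ≤
      hardyEnergy (φ (n + max N N')) := by
    have hc := isCutoff_divRoot (hφ (n + max N N'))
    rw [hardyEnergy_eq (hφ _), integral_add hc.integrableOn_wDens hc.integrableOn_sq]
    have : 0 ≤ ∫ x in unitDisc, divRoot (φ (n + max N N')) x ^ 2 :=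
      integral_nonneg fun x => sq_nonneg _
    linarith
  linarith

/-! ### Tools for passing to the limit. -/

/-- Cauchy–Schwarz, in the form `P Q ≤ τ P²/2 + Q²/(2τ)`. It kills the terms containing `∇χ_n`, with
`Q n` the square root of the cutoff energy density. -/
theorem tendsto_integral_zero_of_abs_le {α : Type*} [MeasurableSpace α] {μ : Measure α}
    {P : α → ℝ} {Q F : ℕ → α → ℝ} (hP : Integrable (fun x => P x ^ 2) μ)
    (hQ : ∀ n, Integrable (fun x => Q n x ^ 2) μ)
    (hF : ∀ n, ∀ᵐ x ∂μ, |F n x| ≤ P x * Q n x)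
    (hlim : Tendsto (fun n => ∫ x, Q n x ^ 2 ∂μ) atTop (𝓝 0)) :
    Tendsto (fun n => ∫ x, F n x ∂μ) atTop (𝓝 0) := by
  set A := ∫ x, P x ^ 2 ∂μ with hA
  have hA0 : 0 ≤ A := integral_nonneg fun x => sq_nonneg _
  rw [Metric.tendsto_atTop']
  intro ε hε
  -- This choice makes the first term at most `ε/2`; the `+ 1` covers the case `A = 0`.
  set τ := ε / (A + 1) with hτ
  have hτ0 : 0 < τ := by positivity
  have hev := hlim.eventually (gt_mem_nhds (show 0 < ε * τ by positivity))
  obtain ⟨N, hN⟩ := eventually_atTop.1 hev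
  refine ⟨N, fun n hn => ?_⟩
  have hb : ‖∫ x, F n x ∂μ‖ ≤ ∫ x, (τ / 2 * P x ^ 2 + 1 / (2 * τ) * Q n x ^ 2) ∂μ := by
    refine norm_integral_le_of_norm_le ((hP.const_mul _).add ((hQ n).const_mul _)) ?_
    filter_upwards [hF n] with x hx
    refine hx.trans ?_
    have : τ / 2 * P x ^ 2 + 1 / (2 * τ) * Q n x ^ 2 - P x * Q n x =
        (τ * P x - Q n x) ^ 2 / (2 * τ) := by field_simp; ring
    have h2 : 0 ≤ (τ * P x - Q n x) ^ 2 / (2 * τ) := by positivity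
    linarith
  rw [integral_add (hP.const_mul _) ((hQ n).const_mul _), integral_const_mul, integral_const_mul,
    ← hA] at hb
  rw [dist_zero_right]
  have h1 : τ / 2 * A ≤ ε / 2 := by
    rw [hτ]
    have : ε / (A + 1) / 2 * A = ε / 2 * (A / (A + 1)) := by field_simp
    rw [this]
    have : A / (A + 1) ≤ 1 := by rw [div_le_one (by positivity)]; linarith
    nlinarith
  have h2 : 1 / (2 * τ) * ∫ x, Q n x ^ 2 ∂μ < ε / 2 := by
    have := hN n hn.le
    calc _ < 1 / (2 * τ) * (ε * τ) := mul_lt_mul_of_pos_left this (by positivity)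
      _ = _ := by field_simp
  linarith

theorem tendsto_integral_mul_of_L2 {α : Type*} [MeasurableSpace α] {μ : Measure α}
    {φ : ℕ → α → ℝ} {u g : α → ℝ} (hφ : ∀ n, MemLp (φ n) 2 μ) (hu : MemLp u 2 μ)
    (hg : MemLp g 2 μ) (h : Tendsto (fun n => eLpNorm (φ n - u) 2 μ) atTop (𝓝 0)) :
    Tendsto (fun n => ∫ x, φ n x * g x ∂μ) atTop (𝓝 (∫ x, u x * g x ∂μ)) := by
  refine tendsto_integral_of_L1' _ (hu.integrable_mul hg).1
    (.of_forall fun n => (hφ n).integrable_mul hg) ?_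
  have hle : ∀ n, eLpNorm ((fun x => φ n x * g x) - fun x => u x * g x) 1 μ ≤
      eLpNorm (φ n - u) 2 μ * eLpNorm g 2 μ := fun n => by
    have := eLpNorm_smul_le_mul_eLpNorm (p := 2) (q := 2) (r := 1) hg.1
      ((hφ n).sub hu).1
    refine le_trans (le_of_eq (congrArg (fun F => eLpNorm F 1 μ) ?_)) this
    ext x; simp; ring
  have h0 : Tendsto (fun n => eLpNorm (φ n - u) 2 μ * eLpNorm g 2 μ) atTop (𝓝 0) := by
    simpa using ENNReal.Tendsto.mul_const h (Or.inr hg.2.ne)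
  exact tendsto_of_tendsto_of_tendsto_of_le_of_le tendsto_const_nhds h0 (fun _ => zero_le) hle

/-- Fatou's lemma along the cutoffs. The lower integral lets it apply before `G` is known to be
integrable. -/
theorem lintegral_le_of_cutoff {χ : ℕ → Plane → ℝ} {G : Plane → ℝ} {c : ℕ → ℝ} {c₀ : ℝ}
    (hχ : ∀ n, IsCutoff (χ n)) (h0 : ∀ n x, 0 ≤ χ n x)
    (h1 : ∀ x ∈ unitDisc, ∀ᶠ n in atTop, χ n x = 1)
    (hG : ContinuousOn G unitDisc) (hG0 : ∀ x ∈ unitDisc, 0 ≤ G x)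
    (hc : ∀ n, ∫ x in unitDisc, χ n x * G x ≤ c n) (hlim : Tendsto c atTop (𝓝 c₀)) :
    ∫⁻ x in unitDisc, ENNReal.ofReal (G x) ≤ ENNReal.ofReal c₀ := by
  calc ∫⁻ x in unitDisc, ENNReal.ofReal (G x)
      = ∫⁻ x in unitDisc, liminf (fun n => ENNReal.ofReal (χ n x * G x)) atTop := by
        refine setLIntegral_congr_fun measurableSet_unitDisc fun x hx => ?_
        refine (Tendsto.liminf_eq ?_).symm
        refine tendsto_const_nhds.congr' ?_
        filter_upwards [h1 x hx] with n hn
        rw [hn, one_mul]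
    _ ≤ liminf (fun n => ∫⁻ x in unitDisc, ENNReal.ofReal (χ n x * G x)) atTop := by
        refine lintegral_liminf_le' fun n => ?_
        exact ((hχ n).integrableOn_mul hG).1.aemeasurable.ennreal_ofReal
    _ ≤ liminf (fun n => ENNReal.ofReal (c n)) atTop := by
        refine liminf_le_liminf (.of_forall fun n => ?_)
        rw [← ofReal_integral_eq_lintegral_ofReal ((hχ n).integrableOn_mul hG)]
        · exact ENNReal.ofReal_le_ofReal (hc n)
        · filter_upwards [ae_restrict_mem measurableSet_unitDisc] with x hx
          exact mul_nonneg (h0 n x) (hG0 x hx)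
    _ = _ := (ENNReal.tendsto_ofReal hlim).liminf_eq

/-! ### Finite weighted energy of the quotient. -/

theorem continuousOn_wDens {v : Plane → ℝ} (hv : ContDiffOn ℝ 1 v unitDisc) :
    ContinuousOn (wDens v) unitDisc := by
  have h : ∀ i, ContinuousOn (pd i v) unitDisc := fun i =>
    (hv.pd (m := 0) isOpen_unitDisc (by norm_num) i).continuousOn
  exact (contDiff_disc (n := 0)).continuous.continuousOn.mul (((h 0).pow 2).add ((h 1).pow 2))

theorem wDens_nonneg (v : Plane → ℝ) {x : Plane} (hx : x ∈ unitDisc) : 0 ≤ wDens v x :=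
  mul_nonneg (mem_unitDisc.1 hx).le (by positivity)

theorem contDiffOn_disc_mul_pd {v : Plane → ℝ} (hv : ContDiffOn ℝ 2 v unitDisc) (i : Fin 2) :
    ContDiffOn ℝ 1 (fun x => disc x * pd i v x) unitDisc :=
  contDiff_disc.contDiffOn.mul (hv.pd isOpen_unitDisc (by norm_num) i)

/-- Weak lower semicontinuity of the weighted energy. The `φ n` converge to `u` only in `L²`, so
derivatives are moved onto the fixed field `χ (1 - |x|²) ∇v` before the limit is taken. -/
theorem integral_cutoff_wDens_le {u : Plane → ℝ} {φ : ℕ → Plane → ℝ} {M : ℝ}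
    (hu : ContDiffOn ℝ 2 u unitDisc) (hu2 : MemLp u 2 (volume.restrict unitDisc))
    (hφ : ∀ n, IsTestFunction (φ n))
    (hM : ∀ n, ∫ x in unitDisc, wDens (divRoot (φ n)) x ≤ M)
    (hL : Tendsto (fun n => eLpNorm (φ n - u) 2 (volume.restrict unitDisc)) atTop (𝓝 0))
    {χ : Plane → ℝ} (hχ : IsCutoff χ) (h0 : ∀ x, 0 ≤ χ x) (h1 : ∀ x, χ x ≤ 1) :
    ∫ x in unitDisc, χ x * wDens (divRoot u) x ≤ M := by
  set v := divRoot u with hvdef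
  have hv : ContDiffOn ℝ 2 v unitDisc := contDiffOn_divRoot hu
  have hv1 : ContDiffOn ℝ 1 v unitDisc := hv.of_le (by norm_num)
  have hF := contDiffOn_disc_mul_pd hv
  have hpF : ∀ i, ContinuousOn (pd i (fun x => disc x * pd i v x)) unitDisc := fun i =>
    ((hF i).pd (m := 0) isOpen_unitDisc (by norm_num) i).continuousOn
  have hχF : ∀ i, ContDiffOn ℝ 1 (fun x => χ x * (disc x * pd i v x)) unitDisc := fun i =>
    hχ.contDiff.contDiffOn.mul (hF i)
  have hpd : ∀ i, ∀ x ∈ unitDisc, pd i (fun x => χ x * (disc x * pd i v x)) x =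
      pd i χ x * (disc x * pd i v x) + χ x * pd i (fun x => disc x * pd i v x) x :=
    fun i x hx => ((HasPd.of_differentiableAt (hχ.contDiff.differentiable (by norm_num) x)).mul
      (.of_differentiableAt ((hF i).differentiableAt_disc (by norm_num) hx))).2
  -- the divergence of `χ (1 - |x|²) ∇v`, divided by the root
  set g : Fin 2 → Plane → ℝ := fun i x => pd i χ x * ((disc x * pd i v x) * (rootDisc x)⁻¹) +
    χ x * (pd i (fun x => disc x * pd i v x) x * (rootDisc x)⁻¹) with hg
  have hri : ContinuousOn (fun x => (rootDisc x)⁻¹) unitDisc :=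
    (contDiffOn_rootDisc_inv (n := 0)).continuousOn
  have hgL : ∀ i, MemLp (g i) 2 (volume.restrict unitDisc) := fun i => by
    have hA : Continuous (fun x => pd i χ x * ((disc x * pd i v x) * (rootDisc x)⁻¹)) :=
      continuous_mul_of_tsupport (hχ.continuous_pd i)
        ((IsCutoff.tsupport_pd_subset χ i).trans hχ.subset) ((hF i).continuousOn.mul hri)
    have hB : Continuous (fun x => χ x * (pd i (fun x => disc x * pd i v x) x * (rootDisc x)⁻¹)) :=
      continuous_mul_of_tsupport hχ.contDiff.continuous hχ.subset ((hpF i).mul hri)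
    exact ((hA.memLp_of_hasCompactSupport (hχ.compact_pd i).mul_right).restrict _).add
      ((hB.memLp_of_hasCompactSupport hχ.compact.mul_right).restrict _)
  have hgeq : ∀ (ψ : Plane → ℝ) (i : Fin 2), ∀ x ∈ unitDisc,
      divRoot ψ x * pd i (fun x => χ x * (disc x * pd i v x)) x = ψ x * g i x :=
    fun ψ i x hx => by rw [hpd i x hx, hg, divRoot]; ring
  have hI : ∀ n i, ∫ x in unitDisc, pd i (divRoot (φ n)) x * (χ x * (disc x * pd i v x)) =
      -∫ x in unitDisc, φ n x * g i x := fun n i => by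
    rw [(isCutoff_divRoot (hφ n)).integral_pd_mul (hχF i)]
    congr 1
    exact setIntegral_congr_fun measurableSet_unitDisc (hgeq _ i)
  have iD : ∀ i, IntegrableOn (fun x => χ x * (disc x * pd i v x ^ 2)) unitDisc := fun i =>
    hχ.integrableOn_mul (((hF i).continuousOn.mul
      (hv.pd (m := 1) isOpen_unitDisc (by norm_num) i).continuousOn).congr fun x _ => by simp only [Pi.mul_apply]; ring)
  have hV : ∀ i, ∫ x in unitDisc, u x * g i x =
      -∫ x in unitDisc, χ x * (disc x * pd i v x ^ 2) := fun i => by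
    have hvF : ContDiffOn ℝ 1 (fun x => v x * (disc x * pd i v x)) unitDisc := hv1.mul (hF i)
    have hb := hχ.integral_pd_mul hvF i
    have hpt : ∀ x ∈ unitDisc, χ x * pd i (fun x => v x * (disc x * pd i v x)) x =
        χ x * (disc x * pd i v x ^ 2) + χ x * (v x * pd i (fun x => disc x * pd i v x) x) :=
      fun x hx => by
        rw [((HasPd.of_differentiableAt (hv1.differentiableAt_disc (by norm_num) hx)).mul
          (.of_differentiableAt ((hF i).differentiableAt_disc (by norm_num) hx))).2]
        ring
    have i2 : IntegrableOn (fun x => χ x * (v x * pd i (fun x => disc x * pd i v x) x)) unitDisc :=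
      hχ.integrableOn_mul (hv1.continuousOn.mul (hpF i))
    have i3 := hχ.integrableOn_pd_mul hvF.continuousOn i
    rw [setIntegral_congr_fun measurableSet_unitDisc hpt, integral_add (iD i) i2] at hb
    have : ∫ x in unitDisc, u x * g i x =
        ∫ x in unitDisc, (pd i χ x * (v x * (disc x * pd i v x)) +
          χ x * (v x * pd i (fun x => disc x * pd i v x) x)) := by
      refine setIntegral_congr_fun measurableSet_unitDisc fun x hx => ?_
      simp only [hg, hvdef, divRoot]; ring
    rw [this, integral_add i3 i2]
    linarith
  have hlim : Tendsto (fun n => ∑ i, ∫ x in unitDisc,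
      pd i (divRoot (φ n)) x * (χ x * (disc x * pd i v x))) atTop
      (𝓝 (∑ i, ∫ x in unitDisc, χ x * (disc x * pd i v x ^ 2))) := by
    refine tendsto_finsetSum _ fun i _ => ?_
    have := (tendsto_integral_mul_of_L2 (fun n => ((hφ n).smooth.continuous.memLp_of_hasCompactSupport
      (hφ n).compact_support).restrict unitDisc) hu2 (hgL i) hL).neg
    rw [hV i, neg_neg] at this
    exact this.congr fun n => (hI n i).symm
  have hsum : ∑ i, ∫ x in unitDisc, χ x * (disc x * pd i v x ^ 2) =
      ∫ x in unitDisc, χ x * wDens v x := by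
    rw [Fin.sum_univ_two, ← integral_add (iD 0) (iD 1)]
    congr 1; ext x; simp [wDens]; ring
  rw [hsum] at hlim
  -- From `2 a·b ≤ |a|² + |b|²` and `0 ≤ χ ≤ 1`. In the limit the left side is twice the cutoff
  -- energy of `v`, which is finite, so one copy can be absorbed.
  have hbound : ∀ n, 2 * ∑ i, ∫ x in unitDisc,
      pd i (divRoot (φ n)) x * (χ x * (disc x * pd i v x)) ≤
      M + ∫ x in unitDisc, χ x * wDens v x := fun n => by
    have hc := isCutoff_divRoot (hφ n)
    have iC : ∀ i, IntegrableOn (fun x => pd i (divRoot (φ n)) x * (χ x * (disc x * pd i v x)))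
        unitDisc := fun i => hc.integrableOn_pd_mul (hχF i).continuousOn i
    have iW := hχ.integrableOn_mul (continuousOn_wDens hv1)
    refine le_trans ?_ (add_le_add_left (hM n) _)
    rw [Fin.sum_univ_two, ← integral_add (iC 0) (iC 1), ← integral_const_mul,
      ← integral_add hc.integrableOn_wDens iW]
    refine setIntegral_mono_on (((iC 0).add (iC 1)).const_mul 2)
      (hc.integrableOn_wDens.add iW) measurableSet_unitDisc fun x hx => ?_
    have ha := (mem_unitDisc.1 hx).le
    have hχw : χ x * wDens (divRoot (φ n)) x ≤ wDens (divRoot (φ n)) x :=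
      mul_le_of_le_one_left (wDens_nonneg _ hx) (h1 x)
    have hsq : ∀ i, 0 ≤ χ x * (disc x * (pd i (divRoot (φ n)) x - pd i v x) ^ 2) := fun i =>
      mul_nonneg (h0 x) (mul_nonneg ha (sq_nonneg _))
    have e0 := hsq 0
    have e1 := hsq 1
    unfold wDens at hχw ⊢
    nlinarith
  have := le_of_tendsto' (hlim.const_mul 2) hbound
  linarith

/-- The weighted Dirichlet energy of a `C²` element of the Hardy space is finite. -/
theorem MemHardySpace.integrableOn_wDens {u : Plane → ℝ} (hu : ContDiffOn ℝ 2 u unitDisc)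
    (hH : MemHardySpace u) : IntegrableOn (wDens (divRoot u)) unitDisc := by
  obtain ⟨M, φ, hφ, hM, hL⟩ := hH.exists_seq
  obtain ⟨χ, hχ, h0, h1, hone, -⟩ := exists_cutoff_seq
  have hcont := continuousOn_wDens (contDiffOn_divRoot (hu.of_le (m := 1) (by norm_num)))
  have hle := lintegral_le_of_cutoff hχ h0 hone hcont (fun x hx => wDens_nonneg _ hx)
    (fun n => integral_cutoff_wDens_le hu hH.1 hφ hM hL (hχ n) (h0 n) (h1 n))
    tendsto_const_nhds
  refine ⟨hcont.aestronglyMeasurable measurableSet_unitDisc, ?_⟩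
  rw [hasFiniteIntegral_iff_ofReal]
  · exact hle.trans_lt ENNReal.ofReal_lt_top
  · filter_upwards [ae_restrict_mem measurableSet_unitDisc] with x hx using wDens_nonneg _ hx

/-! ### The equation for the quotient and the maximum principle. -/

/-- The divergence of `(1 - |x|²) ∇v`. -/
noncomputable def wDiv (v : Plane → ℝ) (x : Plane) : ℝ :=
  pd 0 (fun y => disc y * pd 0 v y) x + pd 1 (fun y => disc y * pd 1 v y) x

theorem continuousOn_wDiv {v : Plane → ℝ} (hv : ContDiffOn ℝ 2 v unitDisc) :
    ContinuousOn (wDiv v) unitDisc := by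
  have h : ∀ i, ContinuousOn (pd i (fun x => disc x * pd i v x)) unitDisc := fun i =>
    ((contDiffOn_disc_mul_pd hv i).pd (m := 0) isOpen_unitDisc (by norm_num) i).continuousOn
  exact (h 0).add (h 1)

/-- The equation satisfied by the quotient of `u` by the supersolution. -/
theorem wDiv_divRoot {u : Plane → ℝ} (hu : ContDiffOn ℝ 2 u unitDisc) {x : Plane}
    (hx : x ∈ unitDisc) :
    wDiv (divRoot u) x = divRoot u x -
      rootDisc x * (-(Δ u x) - 1 / (1 - ‖x‖ ^ 2) ^ 2 * u x) := by
  set v := divRoot u with hv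
  have hu1 : ContDiffOn ℝ 1 u unitDisc := hu.of_le (by norm_num)
  have hv2 : ContDiffOn ℝ 2 v unitDisc := contDiffOn_divRoot hu
  have hvd : ∀ i, HasPd i v (pd i v x) x := fun i =>
    .of_differentiableAt (hv2.differentiableAt_disc (by norm_num) hx)
  have hvdd : ∀ i, HasPd i (pd i v) (pd i (pd i v) x) x := fun i =>
    .of_differentiableAt ((hv2.pd (m := 1) isOpen_unitDisc (by norm_num) i).differentiableAt_disc
      (by norm_num) hx)
  have hr := rootDisc_pos hx
  -- The product formula for `pd i u` holds in a neighbourhood of `x`, so it can be differentiated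
  -- once more.
  have hpu : ∀ i, HasPd i (pd i u) _ x := fun i =>
    ((((((HasPd.const 0).sub (HasPd.coord i)).mul
      ((hasPd_rootDisc i hx).inv hr.ne')).mul (hvd i)).add
      ((hasPd_rootDisc i hx).mul (hvdd i))).congr_of_eventuallyEq (by
        filter_upwards [unitDisc_mem_nhds hx] with y hy
        rw [(hasPd_of_divRoot hu1 i hy).2, ← hv]
        ring))
  rw [laplacian_eq_pd (hu.contDiffAt (unitDisc_mem_nhds hx)), (hpu 0).2, (hpu 1).2, wDiv,
    ((hasPd_disc 0 x).mul (hvdd 0)).2, ((hasPd_disc 1 x).mul (hvdd 1)).2, ← disc_eq,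
    eq_rootDisc_mul_divRoot u hx, ← hv, ← rootDisc_sq hx]
  have hx2 : x 0 ^ 2 = 1 - rootDisc x ^ 2 - x 1 ^ 2 := by
    rw [rootDisc_sq hx, disc]; ring
  simp only [if_true]
  field_simp
  ring_nf
  simp only [hx2]
  ring

/-- Cauchy–Schwarz in the plane: by Lagrange's identity the defect is the square of a determinant.
-/
theorem sum_sq_pd_le {v χ : Plane → ℝ} {x : Plane} (hx : x ∈ unitDisc) :
    |disc x * (pd 0 χ x * pd 0 v x + pd 1 χ x * pd 1 v x)| ≤
      Real.sqrt (wDens v x) * Real.sqrt (wDens χ x) := by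
  rw [← Real.sqrt_mul (wDens_nonneg v hx), ← Real.sqrt_sq_eq_abs]
  apply Real.sqrt_le_sqrt
  have := sq_nonneg (pd 0 χ x * pd 1 v x - pd 1 χ x * pd 0 v x)
  have h2 : 0 ≤ disc x ^ 2 * (pd 0 χ x * pd 1 v x - pd 1 χ x * pd 0 v x) ^ 2 := by positivity
  unfold wDens
  nlinarith

/-- Green's first identity against a cutoff. -/
theorem IsCutoff.integral_mul_wDiv {χ F v : Plane → ℝ} (hχ : IsCutoff χ)
    (hF : ContDiffOn ℝ 1 F unitDisc) (hv : ContDiffOn ℝ 2 v unitDisc) :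
    ∫ x in unitDisc, F x * (disc x * (pd 0 χ x * pd 0 v x + pd 1 χ x * pd 1 v x)) =
      -∫ x in unitDisc, χ x * (disc x * (pd 0 F x * pd 0 v x + pd 1 F x * pd 1 v x) +
        F x * wDiv v x) := by
  have hD := contDiffOn_disc_mul_pd hv
  have hFD : ∀ i, ContDiffOn ℝ 1 (fun x => F x * (disc x * pd i v x)) unitDisc := fun i =>
    hF.mul (hD i)
  have i1 := fun i => hχ.integrableOn_pd_mul (hFD i).continuousOn i
  have i2 : ∀ i, IntegrableOn (fun x => χ x * pd i (fun x => F x * (disc x * pd i v x)) x)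
      unitDisc := fun i =>
    hχ.integrableOn_mul ((hFD i).pd (m := 0) isOpen_unitDisc (by norm_num) i).continuousOn
  calc _ = ∫ x in unitDisc, (pd 0 χ x * (F x * (disc x * pd 0 v x)) +
        pd 1 χ x * (F x * (disc x * pd 1 v x))) := by congr 1; ext x; ring
    _ = -∫ x in unitDisc, (χ x * pd 0 (fun x => F x * (disc x * pd 0 v x)) x +
        χ x * pd 1 (fun x => F x * (disc x * pd 1 v x)) x) := by
      rw [integral_add (i1 0) (i1 1), integral_add (i2 0) (i2 1), hχ.integral_pd_mul (hFD 0),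
        hχ.integral_pd_mul (hFD 1)]
      ring
    _ = _ := by
      congr 1
      refine setIntegral_congr_fun measurableSet_unitDisc fun x hx => ?_
      have hm : ∀ i, pd i (fun x => F x * (disc x * pd i v x)) x = _ := fun i =>
        ((HasPd.of_differentiableAt (hF.differentiableAt_disc (by norm_num) hx)).mul
          (.of_differentiableAt ((hD i).differentiableAt_disc (by norm_num) hx))).2
      simp only [hm, wDiv]
      ring

/-- The weak maximum principle in the Hardy space. -/
theorem MemHardySpace.nonneg {u : Plane → ℝ} (hu : ContDiffOn ℝ 2 u unitDisc)
    (hH : MemHardySpace u)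
    (hf : ∀ x ∈ unitDisc, 0 ≤ -(Δ u x) - 1 / (1 - ‖x‖ ^ 2) ^ 2 * u x) :
    ∀ x ∈ unitDisc, 0 ≤ u x := by
  obtain ⟨χ, hχ, h0, h1, hone, hcap⟩ := exists_cutoff_seq
  set v := divRoot u with hvdef
  have hv : ContDiffOn ℝ 2 v unitDisc := contDiffOn_divRoot hu
  have hv1 : ContDiffOn ℝ 1 v unitDisc := hv.of_le (by norm_num)
  -- A smooth, bounded substitute for minus the negative part: increasing, negative exactly on `s <
  -- 0`. Smoothness permits integration by parts, and `|g| ≤ 1` controls the term with `∇χ_n` by the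
  -- energy of `v`.
  set g : ℝ → ℝ := fun s => -Real.smoothTransition (-s) with hg
  have hgs : ContDiff ℝ 1 g := (Real.smoothTransition.contDiff.comp contDiff_neg).neg
  have hgm : Monotone g := fun s t hst =>
    neg_le_neg (Real.smoothTransition.monotone (neg_le_neg hst))
  have hg0 : ∀ s, g s ≤ 0 := fun s => neg_nonpos.2 (Real.smoothTransition.nonneg _)
  have hgb : ∀ s, |g s| ≤ 1 := fun s => by
    rw [hg, abs_neg, abs_of_nonneg (Real.smoothTransition.nonneg _)]
    exact Real.smoothTransition.le_one _
  have hgs0 : ∀ s, 0 ≤ s → g s = 0 := fun s hs => by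
    simp [hg, Real.smoothTransition.zero_of_nonpos (neg_nonpos.2 hs)]
  have hgneg : ∀ s, s < 0 → g s < 0 := fun s hs =>
    neg_lt_zero.2 (Real.smoothTransition.pos_of_pos (neg_pos.2 hs))
  have hgv : ∀ s, 0 ≤ g s * s := fun s => by
    rcases le_or_gt 0 s with h | h
    · rw [hgs0 s h, zero_mul]
    · exact (mul_pos_of_neg_of_neg (hgneg s h) h).le
  have hF : ContDiffOn ℝ 1 (fun x => g (v x)) unitDisc := hgs.comp_contDiffOn hv1
  have hpF : ∀ i, ∀ x ∈ unitDisc, pd i (fun x => g (v x)) x = deriv g (v x) * pd i v x :=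
    fun i x hx => ((HasPd.of_differentiableAt (hv1.differentiableAt_disc (by norm_num) hx)).comp
      ((hgs.differentiable (by norm_num) _).hasDerivAt)).2
  have hcv : ContinuousOn (fun x => g (v x) * v x) unitDisc := hF.continuousOn.mul hv1.continuousOn
  set T : ℕ → ℝ := fun n => ∫ x in unitDisc,
    g (v x) * (disc x * (pd 0 (χ n) x * pd 0 v x + pd 1 (χ n) x * pd 1 v x)) with hT
  have hTlim : Tendsto T atTop (𝓝 0) := by
    refine tendsto_integral_zero_of_abs_le (P := fun x => Real.sqrt (wDens v x))
      (Q := fun n x => Real.sqrt (wDens (χ n) x)) ?_ (fun n => ?_) (fun n => ?_) ?_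
    · exact (hH.integrableOn_wDens hu).congr_fun
        (fun x hx => (Real.sq_sqrt (wDens_nonneg _ hx)).symm) measurableSet_unitDisc
    · exact ((hχ n).integrableOn_wDens).congr_fun
        (fun x hx => (Real.sq_sqrt (wDens_nonneg _ hx)).symm) measurableSet_unitDisc
    · filter_upwards [ae_restrict_mem measurableSet_unitDisc] with x hx
      rw [abs_mul]
      exact (mul_le_of_le_one_left (abs_nonneg _) (hgb _)).trans (sum_sq_pd_le hx)
    · refine hcap.congr fun n => ?_
      exact setIntegral_congr_fun measurableSet_unitDisc
        fun x hx => (Real.sq_sqrt (wDens_nonneg (χ n) hx)).symm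
  -- Testing the equation with `χ_n g(v)`: the terms `g'(v)(1 - |x|²)|∇v|²` and `-g(v) r f` are
  -- nonnegative and are discarded.
  have hle : ∀ n, ∫ x in unitDisc, χ n x * (g (v x) * v x) ≤ -T n := fun n => by
    rw [show T n = _ from (hχ n).integral_mul_wDiv hF hv, neg_neg]
    refine setIntegral_mono_on ((hχ n).integrableOn_mul hcv) ((hχ n).integrableOn_mul ?_)
      measurableSet_unitDisc fun x hx => ?_
    · have hp : ∀ {w : Plane → ℝ}, ContDiffOn ℝ 1 w unitDisc → ∀ i,
          ContinuousOn (pd i w) unitDisc := fun hw i =>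
        (hw.pd (m := 0) isOpen_unitDisc (by norm_num) i).continuousOn
      exact ((contDiff_disc (n := 0)).continuous.continuousOn.mul
        (((hp hF 0).mul (hp hv1 0)).add ((hp hF 1).mul (hp hv1 1)))).add
        (hF.continuousOn.mul (continuousOn_wDiv hv))
    · refine mul_le_mul_of_nonneg_left ?_ (h0 n x)
      rw [hpF 0 x hx, hpF 1 x hx, wDiv_divRoot hu hx]
      have e1 : 0 ≤ deriv g (v x) * wDens v x :=
        mul_nonneg hgm.deriv_nonneg (wDens_nonneg v hx)
      have e2 : 0 ≤ -g (v x) * (rootDisc x * (-(Δ u x) - 1 / (1 - ‖x‖ ^ 2) ^ 2 * u x)) :=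
        mul_nonneg (neg_nonneg.2 (hg0 _)) (mul_nonneg (rootDisc_pos hx).le (hf x hx))
      unfold wDens at e1
      rw [← hvdef]
      linarith
  have hz := lintegral_le_of_cutoff hχ h0 hone hcv (fun x _ => hgv _) hle hTlim.neg
  rw [neg_zero, ENNReal.ofReal_zero, nonpos_iff_eq_zero,
    lintegral_eq_zero_iff' (hcv.aestronglyMeasurable
      measurableSet_unitDisc).aemeasurable.ennreal_ofReal] at hz
  have hae : (fun x => g (v x) * v x) =ᵐ[volume.restrict unitDisc] fun _ => 0 := by
    filter_upwards [hz] with x hx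
    exact le_antisymm (ENNReal.ofReal_eq_zero.1 hx) (hgv _)
  -- Continuity upgrades almost everywhere vanishing of `g(v) v` to every point of the disc.
  have heq := Measure.eqOn_open_of_ae_eq hae isOpen_unitDisc hcv continuousOn_const
  intro x hx
  rw [eq_rootDisc_mul_divRoot u hx]
  refine mul_nonneg (rootDisc_pos hx).le ?_
  by_contra hlt
  have hlt' : v x < 0 := not_le.1 hlt
  exact (mul_pos_of_neg_of_neg (hgneg _ hlt') hlt').ne' (heq hx)

/-! ### The comparison kernel and its derivatives. -/

/-- `|1 - x̄ y|²` in complex notation. -/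
noncomputable def moebDen (x y : Plane) : ℝ :=
  1 - 2 * (x 0 * y 0 + x 1 * y 1) + (x 0 ^ 2 + x 1 ^ 2) * (y 0 ^ 2 + y 1 ^ 2)

/-- The regularized squared distance. -/
noncomputable def regDist (ε : ℝ) (x y : Plane) : ℝ :=
  (y 0 - x 0) ^ 2 + (y 1 - x 1) ^ 2 + ε ^ 2

theorem regDist_eq (ε : ℝ) (x y : Plane) : regDist ε x y = ‖x - y‖ ^ 2 + ε ^ 2 := by
  rw [norm_sq_plane, regDist]; simp; ring

theorem moebDen_eq (x y : Plane) : moebDen x y = ‖x - y‖ ^ 2 + disc x * disc y := by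
  rw [norm_sq_plane, moebDen, disc, disc]; simp; ring

theorem contDiff_moebDen (x : Plane) {n : WithTop ℕ∞} : ContDiff ℝ n (moebDen x) := by
  unfold moebDen; fun_prop

theorem contDiff_regDist (ε : ℝ) (x : Plane) {n : WithTop ℕ∞} : ContDiff ℝ n (regDist ε x) := by
  unfold regDist; fun_prop

theorem hasPd_moebDen (x : Plane) (i : Fin 2) (y : Plane) :
    HasPd i (moebDen x) (-(2 * x i) + 2 * (x 0 ^ 2 + x 1 ^ 2) * y i) y := by
  have h := ((HasPd.const (i := i) (x := y) 1).sub ((HasPd.const (i := i) (x := y) 2).mul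
    (((HasPd.const (i := i) (x := y) (x 0)).mul (HasPd.coord 0)).add
      ((HasPd.const (i := i) (x := y) (x 1)).mul (HasPd.coord 1))))).add
    ((HasPd.const (i := i) (x := y) (x 0 ^ 2 + x 1 ^ 2)).mul
    (((HasPd.coord (i := i) (x := y) 0).mul (HasPd.coord 0)).add
      ((HasPd.coord (i := i) (x := y) 1).mul (HasPd.coord 1))))
  refine (h.congr_deriv ?_).congr_of_eventuallyEq (.of_forall fun z => ?_)
  · fin_cases i <;> simp <;> ring
  · simp only [moebDen]; ring

theorem hasPd_regDist (ε : ℝ) (x : Plane) (i : Fin 2) (y : Plane) :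
    HasPd i (regDist ε x) (2 * (y i - x i)) y := by
  have hc : ∀ j, HasPd i (fun z : Plane => z j - x j) _ y := fun j =>
    (HasPd.coord (i := i) (x := y) j).sub (HasPd.const (x j))
  have h := (((hc 0).mul (hc 0)).add ((hc 1).mul (hc 1))).add
    (HasPd.const (i := i) (x := y) (ε ^ 2))
  refine (h.congr_deriv ?_).congr_of_eventuallyEq (.of_forall fun z => ?_)
  · fin_cases i <;> simp <;> ring
  · simp [regDist]; ring

theorem regDist_pos {ε : ℝ} (hε : 0 < ε) (x y : Plane) : 0 < regDist ε x y := by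
  unfold regDist; positivity

/-- `|1 - x̄ y| ≥ 1 - |x||y| ≥ 1 - |x| ≥ (1 - |x|²)/2`. The bound is uniform up to `|y| = 1`. -/
theorem moebDen_lower {x y : Plane} (hx : x ∈ unitDisc) (hy : ‖y‖ ≤ 1) :
    disc x ^ 2 / 4 ≤ moebDen x y := by
  have h1 : x 0 * y 0 + x 1 * y 1 ≤ ‖x‖ * ‖y‖ := by
    have := real_inner_le_norm x y
    rw [PiLp.inner_apply, Fin.sum_univ_two] at this
    simp at this
    linarith
  have hx1 : ‖x‖ < 1 := mem_ball_zero_iff.1 hx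
  have h2 : moebDen x y ≥ (1 - ‖x‖ * ‖y‖) ^ 2 := by
    rw [moebDen, ← norm_sq_plane, ← norm_sq_plane]; nlinarith
  have h3 : disc x / 2 ≤ 1 - ‖x‖ * ‖y‖ := by
    rw [disc_eq]; nlinarith [norm_nonneg x, norm_nonneg y]
  have h4 : 0 < disc x := mem_unitDisc.1 hx
  nlinarith

theorem moebDen_pos {x y : Plane} (hx : x ∈ unitDisc) (hy : ‖y‖ ≤ 1) : 0 < moebDen x y := by
  have := moebDen_lower hx hy
  have h4 : 0 < disc x := mem_unitDisc.1 hx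
  nlinarith

theorem norm_le_one_of_mem {y : Plane} (hy : y ∈ unitDisc) : ‖y‖ ≤ 1 :=
  (mem_ball_zero_iff.1 hy).le

theorem moebDen_le_four {x y : Plane} (hx : x ∈ unitDisc) (hy : y ∈ unitDisc) :
    moebDen x y ≤ 4 := by
  have a1 := mem_unitDisc.1 hx
  have a2 := mem_unitDisc.1 hy
  unfold disc at a1 a2
  unfold moebDen
  nlinarith [sq_nonneg (x 0 + y 0), sq_nonneg (x 1 + y 1), sq_nonneg (x 0), sq_nonneg (x 1),
    sq_nonneg (y 0), sq_nonneg (y 1)]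

/-- The logarithmic factor of the comparison kernel. -/
noncomputable def logFactor (ε : ℝ) (x y : Plane) : ℝ :=
  1 - (Real.log (regDist ε x y) - Real.log (moebDen x y)) / (4 * Real.pi)

/-- The Möbius factor of the comparison kernel. -/
noncomputable def moebFactor (x y : Plane) : ℝ := rootDisc x * (Real.sqrt (moebDen x y))⁻¹

/-- The comparison kernel, divided by `(1 - |y|²)^{1/2}`. -/
noncomputable def compKernel (ε : ℝ) (x y : Plane) : ℝ := moebFactor x y * logFactor ε x y

section Derivatives

variable {ε : ℝ} {x y : Plane}

theorem hasPd_moebFactor (hp : 0 < moebDen x y) (i : Fin 2) :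
    HasPd i (moebFactor x) (-(moebFactor x y * (-(2 * x i) + 2 * (x 0 ^ 2 + x 1 ^ 2) * y i) /
      (2 * moebDen x y))) y := by
  have hs := Real.sqrt_pos.2 hp
  refine ((HasPd.const (rootDisc x)).mul
    (((hasPd_moebDen x i y).sqrt hp.ne').inv hs.ne')).congr_deriv ?_
  have h2 := Real.sq_sqrt hp.le
  unfold moebFactor
  set s := Real.sqrt (moebDen x y)
  rw [← h2]
  field_simp
  ring

theorem hasPd_logFactor (hε : 0 < ε) (hp : 0 < moebDen x y) (i : Fin 2) :
    HasPd i (logFactor ε x) (-((2 * (y i - x i)) / regDist ε x y -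
      (-(2 * x i) + 2 * (x 0 ^ 2 + x 1 ^ 2) * y i) / moebDen x y) / (4 * Real.pi)) y := by
  have hm := regDist_pos hε x y
  refine (((HasPd.const 1).sub ((((hasPd_regDist ε x i y).log hm.ne').sub
    ((hasPd_moebDen x i y).log hp.ne')).mul (HasPd.const (4 * Real.pi)⁻¹)))).congr_deriv ?_
    |>.congr_of_eventuallyEq (.of_forall fun z => ?_)
  · have := Real.pi_pos
    field_simp; ring
  · simp only [logFactor]; ring

/-- Written with products and inverses only, so that the product rule can be applied to it a second
time. -/
theorem hasPd_compKernel (hε : 0 < ε) (hp : 0 < moebDen x y) (i : Fin 2) :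
    HasPd i (compKernel ε x) (-(moebFactor x y * (-(2 * x i) + 2 * (x 0 ^ 2 + x 1 ^ 2) * y i) *
      (moebDen x y)⁻¹ * (2⁻¹ * logFactor ε x y)) +
      moebFactor x y * (((-(2 * x i) + 2 * (x 0 ^ 2 + x 1 ^ 2) * y i) * (moebDen x y)⁻¹ -
      (2 * (y i - x i)) * (regDist ε x y)⁻¹) * (4 * Real.pi)⁻¹)) y := by
  refine ((hasPd_moebFactor hp i).mul (hasPd_logFactor hε hp i)).congr_deriv ?_
  have hm := regDist_pos hε x y
  have := Real.pi_pos
  field_simp; ring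

theorem isOpen_moebDen_pos (x : Plane) : IsOpen {y | 0 < moebDen x y} :=
  isOpen_lt continuous_const (contDiff_moebDen x (n := 0)).continuous

theorem contDiffOn_compKernel (hε : 0 < ε) (x : Plane) {n : WithTop ℕ∞} :
    ContDiffOn ℝ n (compKernel ε x) {y | 0 < moebDen x y} := by
  intro y hy
  have hp : 0 < moebDen x y := hy
  refine ContDiffAt.contDiffWithinAt ?_
  refine ContDiffAt.mul (contDiffAt_const.mul (((contDiff_moebDen x).contDiffAt.sqrt hp.ne').inv
    (Real.sqrt_pos.2 hp).ne')) (contDiffAt_const.sub (ContDiffAt.div_const ?_ _))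
  exact ((contDiff_regDist ε x).contDiffAt.log (regDist_pos hε x y).ne').sub
    ((contDiff_moebDen x).contDiffAt.log hp.ne')

/-- A direct computation. The first term is the mollified point mass, coming from `Δ log(ρ² + ε²) =
4ε²/(ρ² + ε²)²` with `ρ = |x - y|`. At `ε = 0` the bracket over `moebDen` reduces to `(1 -
|x|²)(logFactor - 1/π)`, and the last summand is the error of the regularization. -/
theorem compKernel_sub_wDiv (hε : 0 < ε) (hx : x ∈ unitDisc) (hy : y ∈ unitDisc) :
    compKernel ε x y - wDiv (compKernel ε x) y = moebFactor x y *
      (disc y * ε ^ 2 / (Real.pi * regDist ε x y ^ 2) +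
      (logFactor ε x y * disc x - disc x * (regDist ε x y - ε ^ 2) / (Real.pi * regDist ε x y) +
        ε ^ 2 * (x 0 * (x 0 - y 0) + x 1 * (x 1 - y 1)) / (Real.pi * regDist ε x y)) /
        moebDen x y) := by
  have hp : 0 < moebDen x y := moebDen_pos hx (norm_le_one_of_mem hy)
  have hm := regDist_pos hε x y
  have hpi := Real.pi_pos
  have hlin : ∀ i, HasPd i (fun y : Plane => -(2 * x i) + 2 * (x 0 ^ 2 + x 1 ^ 2) * y i)
      (2 * (x 0 ^ 2 + x 1 ^ 2)) y := fun i =>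
    ((HasPd.const _).add ((HasPd.const _).mul (HasPd.coord i))).congr_deriv (by simp)
  have hlin2 : ∀ i, HasPd i (fun y : Plane => 2 * (y i - x i)) 2 y := fun i =>
    ((HasPd.const 2).mul ((HasPd.coord i).sub (HasPd.const _))).congr_deriv (by simp)
  have hpd : ∀ i, HasPd i (pd i (compKernel ε x)) _ y := fun i =>
    ((((((HasPd.const 0).sub ((((hasPd_moebFactor hp i).mul (hlin i)).mul
      ((hasPd_moebDen x i y).inv hp.ne')).mul ((HasPd.const 2⁻¹).mul
      (hasPd_logFactor hε hp i)))).add ((hasPd_moebFactor hp i).mul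
      ((((hlin i).mul ((hasPd_moebDen x i y).inv hp.ne')).sub ((hlin2 i).mul
      ((hasPd_regDist ε x i y).inv hm.ne'))).mul (HasPd.const (4 * Real.pi)⁻¹)))))).congr_of_eventuallyEq
      (by
        filter_upwards [(isOpen_moebDen_pos x).mem_nhds hp] with z hz
        rw [(hasPd_compKernel hε hz i).2]; ring))
  rw [wDiv, ((hasPd_disc 0 y).mul (hpd 0)).2, ((hasPd_disc 1 y).mul (hpd 1)).2,
    (hasPd_compKernel hε hp 0).2, (hasPd_compKernel hε hp 1).2, compKernel]
  -- The derivatives have been eliminated, so both factors may be treated as free variables. What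
  -- remains is a rational identity in the four coordinates, `ε` and `π`.
  generalize logFactor ε x y = W
  generalize moebFactor x y = S
  have e1 : moebDen x y = 1 - 2 * (x 0 * y 0 + x 1 * y 1) +
    (x 0 ^ 2 + x 1 ^ 2) * (y 0 ^ 2 + y 1 ^ 2) := rfl
  have e2 : regDist ε x y = (y 0 - x 0) ^ 2 + (y 1 - x 1) ^ 2 + ε ^ 2 := rfl
  have e3 : disc x = 1 - (x 0 ^ 2 + x 1 ^ 2) := rfl
  have e4 : disc y = 1 - (y 0 ^ 2 + y 1 ^ 2) := rfl
  rw [e3, e4]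
  generalize moebDen x y = p at *
  generalize regDist ε x y = m at *
  generalize x 0 = x0 at *
  generalize x 1 = x1 at *
  generalize y 0 = y0 at *
  generalize y 1 = y1 at *
  field_simp
  subst e1 e2
  ring

end Derivatives

/-! ### Supersolution property and pointwise bounds of the kernel. -/

section Bounds

variable {ε : ℝ} {x y : Plane}

theorem moebFactor_pos (hx : x ∈ unitDisc) (hy : ‖y‖ ≤ 1) : 0 < moebFactor x y :=
  mul_pos (rootDisc_pos hx) (inv_pos.2 (Real.sqrt_pos.2 (moebDen_pos hx hy)))

theorem logFactor_lower (hε : 0 < ε) (hx : x ∈ unitDisc) (hεx : ε ≤ disc x) (hy : y ∈ unitDisc) :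
    1 - 1 / Real.pi ≤ logFactor ε x y := by
  have hp := moebDen_pos hx (norm_le_one_of_mem hy)
  have hm := regDist_pos hε x y
  have hpl := moebDen_lower hx (norm_le_one_of_mem hy)
  have ha : 0 < disc x * disc y := mul_pos (mem_unitDisc.1 hx) (mem_unitDisc.1 hy)
  -- `|x - y|²` is at most `moebDen`, and `ε² ≤ (1 - |x|²)² ≤ 4 moebDen` by `moebDen_lower`. With
  -- `log t ≤ t - 1` the ratio 5 yields the 4 that cancels against `4π`.
  have hmp : regDist ε x y ≤ 5 * moebDen x y := by
    have h1 := moebDen_eq x y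
    have h2 := regDist_eq ε x y
    nlinarith
  have hlog : Real.log (regDist ε x y) - Real.log (moebDen x y) ≤ 4 := by
    rw [← Real.log_div hm.ne' hp.ne']
    have := Real.log_le_sub_one_of_pos (div_pos hm hp)
    have h5 : regDist ε x y / moebDen x y ≤ 5 := by rwa [div_le_iff₀ hp]
    linarith
  have hpi := Real.pi_pos
  have : (Real.log (regDist ε x y) - Real.log (moebDen x y)) / (4 * Real.pi) ≤ 1 / Real.pi := by
    rw [div_le_div_iff₀ (by positivity) hpi]; nlinarith
  unfold logFactor
  linarith

theorem logFactor_nonneg (hε : 0 < ε) (hx : x ∈ unitDisc) (hεx : ε ≤ disc x)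
    (hy : y ∈ unitDisc) : 0 ≤ logFactor ε x y := by
  have h := logFactor_lower hε hx hεx hy
  have : 1 / Real.pi ≤ 1 := by
    rw [div_le_one Real.pi_pos]; linarith [Real.pi_gt_three]
  linarith

/-- The comparison kernel is a supersolution with a regularized unit mass at `x`. -/
theorem le_compKernel_sub_wDiv (hε : 0 < ε) (hx : x ∈ unitDisc) (hεx : ε ≤ disc x)
    (hy : y ∈ unitDisc) :
    moebFactor x y * (disc y * ε ^ 2 / (Real.pi * regDist ε x y ^ 2)) ≤
      compKernel ε x y - wDiv (compKernel ε x) y := by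
  rw [compKernel_sub_wDiv hε hx hy]
  have hp := moebDen_pos hx (norm_le_one_of_mem hy)
  have hm := regDist_pos hε x y
  have hpi := Real.pi_gt_three
  have hb := mem_unitDisc.1 hx
  have hW := logFactor_lower hε hx hεx hy
  refine mul_le_mul_of_nonneg_left (le_add_of_nonneg_right (div_nonneg ?_ hp.le))
    (moebFactor_pos hx (norm_le_one_of_mem hy)).le
  have h1 : disc x * (regDist ε x y - ε ^ 2) / (Real.pi * regDist ε x y) ≤ disc x / Real.pi := by
    rw [div_le_div_iff₀ (by positivity) (by positivity)]
    nlinarith [mul_pos (mul_pos hb (pow_pos hε 2)) Real.pi_pos]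
  -- With `ρ = |x - y|`, `x · (x - y) ≥ -ρ` and `2ερ ≤ ρ² + ε²` bound the error below by `-ε/(2π)`;
  -- the condition `ε ≤ 1 - |x|²` absorbs it.
  have h2 : -(disc x / (2 * Real.pi)) ≤
      ε ^ 2 * (x 0 * (x 0 - y 0) + x 1 * (x 1 - y 1)) / (Real.pi * regDist ε x y) := by
    set r := ‖x - y‖ with hr
    have hr0 : 0 ≤ r := norm_nonneg _
    have hin : -r ≤ x 0 * (x 0 - y 0) + x 1 * (x 1 - y 1) := by
      have hc := abs_real_inner_le_norm x (x - y)
      rw [PiLp.inner_apply, Fin.sum_univ_two] at hc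
      simp at hc
      have := (abs_le.1 hc).1
      have hx1 : ‖x‖ ≤ 1 := norm_le_one_of_mem hx
      nlinarith
    have hmr : regDist ε x y = r ^ 2 + ε ^ 2 := regDist_eq ε x y
    have h3 : -(ε / 2 * regDist ε x y) ≤ ε ^ 2 * (x 0 * (x 0 - y 0) + x 1 * (x 1 - y 1)) := by
      rw [hmr]
      nlinarith [mul_le_mul_of_nonneg_left hin (sq_nonneg ε), mul_nonneg hε.le (sq_nonneg (r - ε))]
    rw [← neg_div, div_le_div_iff₀ (by positivity) (by positivity)]
    have h4 : disc x * regDist ε x y ≥ ε * regDist ε x y := by gcongr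
    nlinarith [mul_le_mul_of_nonneg_left h3 Real.pi_pos.le]
  have h5 : (1 - 1 / Real.pi) * disc x ≤ logFactor ε x y * disc x :=
    mul_le_mul_of_nonneg_right hW hb.le
  -- The three bounds leave the factor `(π - 5/2)/π`. The additive 1 in `logFactor` provides this
  -- margin.
  have h6 : 0 ≤ (1 - 1 / Real.pi) * disc x - disc x / Real.pi - disc x / (2 * Real.pi) := by
    have : (1 - 1 / Real.pi) * disc x - disc x / Real.pi - disc x / (2 * Real.pi) =
        disc x * (Real.pi - 5 / 2) / Real.pi := by field_simp; ring
    rw [this]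
    have : 0 ≤ Real.pi - 5 / 2 := by linarith
    positivity
  linarith

/-- The product is `(1 - |z|²)^{1/2}` for the Möbius image `z` of `y`. -/
theorem rootDisc_mul_moebFactor_le_one (hx : x ∈ unitDisc) (hy : y ∈ unitDisc) :
    rootDisc y * moebFactor x y ≤ 1 := by
  have hp := moebDen_pos hx (norm_le_one_of_mem hy)
  have h1 : rootDisc y * rootDisc x ≤ Real.sqrt (moebDen x y) := by
    unfold rootDisc
    rw [← Real.sqrt_mul (mem_unitDisc.1 hy).le]
    apply Real.sqrt_le_sqrt
    rw [moebDen_eq]; nlinarith [sq_nonneg ‖x - y‖]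
  rw [moebFactor, ← mul_assoc, ← div_eq_mul_inv, div_le_one (Real.sqrt_pos.2 hp)]
  exact h1

theorem rootDisc_mul_compKernel_nonneg (hε : 0 < ε) (hx : x ∈ unitDisc) (hεx : ε ≤ disc x)
    (hy : y ∈ unitDisc) : 0 ≤ rootDisc y * compKernel ε x y :=
  mul_nonneg (rootDisc_pos hy).le (mul_nonneg (moebFactor_pos hx (norm_le_one_of_mem hy)).le
    (logFactor_nonneg hε hx hεx hy))

theorem rootDisc_mul_compKernel_le (hε : 0 < ε) (hx : x ∈ unitDisc) (hεx : ε ≤ disc x)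
    (hy : y ∈ unitDisc) :
    rootDisc y * compKernel ε x y ≤
      1 + (Real.log 4 - Real.log (regDist ε x y)) / (4 * Real.pi) := by
  have hp := moebDen_pos hx (norm_le_one_of_mem hy)
  have hpi := Real.pi_pos
  calc rootDisc y * compKernel ε x y = rootDisc y * moebFactor x y * logFactor ε x y := by
        rw [compKernel]; ring
    _ ≤ logFactor ε x y := mul_le_of_le_one_left (logFactor_nonneg hε hx hεx hy)
        (rootDisc_mul_moebFactor_le_one hx hy)
    _ ≤ _ := by
        have h4 : Real.log (moebDen x y) ≤ Real.log 4 :=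
          Real.log_le_log hp (moebDen_le_four hx hy)
        have : logFactor ε x y = 1 + (Real.log (moebDen x y) - Real.log (regDist ε x y)) /
            (4 * Real.pi) := by rw [logFactor]; ring
        rw [this]
        gcongr

/-- Makes the kernel smooth on a neighbourhood of the closed disc, so the kernel and its gradient
are bounded up to the circle. -/
theorem closedBall_subset_moebDen_pos (hx : x ∈ unitDisc) :
    Metric.closedBall (0 : Plane) 1 ⊆ {y | 0 < moebDen x y} := fun _ hy =>
  moebDen_pos hx (mem_closedBall_zero_iff.1 hy)

theorem unitDisc_subset_moebDen_pos (hx : x ∈ unitDisc) :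
    unitDisc ⊆ {y | 0 < moebDen x y} :=
  Metric.ball_subset_closedBall.trans (closedBall_subset_moebDen_pos hx)

theorem exists_bound_unitDisc {F : Plane → ℝ} (hF : ContinuousOn F (Metric.closedBall 0 1)) :
    ∃ C, 0 ≤ C ∧ ∀ y ∈ unitDisc, |F y| ≤ C := by
  obtain ⟨C, hC⟩ := (isCompact_closedBall (0 : Plane) 1).exists_bound_of_continuousOn hF
  exact ⟨max C 0, le_max_right _ _, fun y hy =>
    (hC y (Metric.ball_subset_closedBall hy)).trans (le_max_left _ _)⟩

end Bounds

/-! ### Green's second identity against the kernel. -/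

theorem integrableOn_mul_of_continuousOn_closedBall {f F : Plane → ℝ}
    (hf : IntegrableOn f unitDisc) (hF : ContinuousOn F (Metric.closedBall 0 1)) :
    IntegrableOn (fun y => F y * f y) unitDisc := by
  obtain ⟨C, -, hC⟩ := exists_bound_unitDisc hF
  exact hf.bdd_mul (c := C) ((hF.mono Metric.ball_subset_closedBall).aestronglyMeasurable
    measurableSet_unitDisc) (by
    filter_upwards [ae_restrict_mem measurableSet_unitDisc] with y hy using hC y hy)

instance : IsFiniteMeasure (volume.restrict unitDisc) :=
  ⟨by rw [Measure.restrict_apply_univ]; exact measure_ball_lt_top⟩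

theorem MemHardySpace.integrableOn {u : Plane → ℝ} (hH : MemHardySpace u) :
    IntegrableOn u unitDisc := hH.1.integrable (by norm_num)

/-- The mollified weight appearing in the representation of `u`. -/
noncomputable def mollWeight (ε : ℝ) (x y : Plane) : ℝ :=
  rootDisc y * moebFactor x y * (ε ^ 2 / (Real.pi * regDist ε x y ^ 2))

theorem continuousOn_moebFactor {x : Plane} (hx : x ∈ unitDisc) :
    ContinuousOn (moebFactor x) (Metric.closedBall 0 1) := by
  refine continuousOn_const.mul (ContinuousOn.inv₀ ?_ fun y hy => ?_)
  · exact (contDiff_moebDen x (n := 0)).continuous.sqrt.continuousOn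
  · exact (Real.sqrt_pos.2 (closedBall_subset_moebDen_pos hx hy)).ne'

theorem continuousOn_mollWeight {ε : ℝ} (hε : 0 < ε) {x : Plane} (hx : x ∈ unitDisc) :
    ContinuousOn (mollWeight ε x) (Metric.closedBall 0 1) := by
  refine (continuous_rootDisc.continuousOn.mul (continuousOn_moebFactor hx)).mul ?_
  refine (continuous_const.div (continuous_const.mul
    ((contDiff_regDist ε x (n := 0)).continuous.pow 2)) fun y => ?_).continuousOn
  exact (mul_pos Real.pi_pos (pow_pos (regDist_pos hε x y) 2)).ne'

/-- The equation for `v` is tested with `χ_n k` and the supersolution inequality for `k` with `χ_n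
v`. The difference leaves only `T₁` and `T₂`, which contain `∇χ_n` and tend to zero. -/
theorem integral_mollWeight_le {u f : Plane → ℝ} (hu : ContDiffOn ℝ 2 u unitDisc)
    (hH : MemHardySpace u)
    (hpde : ∀ x ∈ unitDisc, -(Δ u x) - 1 / (1 - ‖x‖ ^ 2) ^ 2 * u x = f x)
    (hf0 : ∀ x ∈ unitDisc, 0 ≤ f x) (hf : IntegrableOn f unitDisc)
    {x : Plane} (hx : x ∈ unitDisc) {ε : ℝ} (hε : 0 < ε) (hεx : ε ≤ disc x) :
    ∫ y in unitDisc, mollWeight ε x y * u y ≤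
      ∫ y in unitDisc, rootDisc y * compKernel ε x y * f y := by
  obtain ⟨χ, hχ, h0, h1, hone, hcap⟩ := exists_cutoff_seq
  have hu0 := hH.nonneg hu (fun z hz => (hpde z hz).symm ▸ hf0 z hz)
  set v := divRoot u with hvdef
  set k := compKernel ε x with hk
  have hv : ContDiffOn ℝ 2 v unitDisc := contDiffOn_divRoot hu
  have hv1 : ContDiffOn ℝ 1 v unitDisc := hv.of_le (by norm_num)
  have hkU : ContDiffOn ℝ 2 k {y | 0 < moebDen x y} := contDiffOn_compKernel hε x
  have hk2 : ContDiffOn ℝ 2 k unitDisc := hkU.mono (unitDisc_subset_moebDen_pos hx)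
  have hk1 : ContDiffOn ℝ 1 k unitDisc := hk2.of_le (by norm_num)
  have hpk : ∀ i, ContinuousOn (pd i k) (Metric.closedBall 0 1) := fun i =>
    ((hkU.pd (m := 0) (isOpen_moebDen_pos x) (by norm_num) i).continuousOn).mono
      (closedBall_subset_moebDen_pos hx)
  have hkc : ContinuousOn k (Metric.closedBall 0 1) :=
    hkU.continuousOn.mono (closedBall_subset_moebDen_pos hx)
  obtain ⟨C₁, hC₁0, hC₁⟩ := exists_bound_unitDisc hkc
  obtain ⟨C₂, hC₂0, hC₂⟩ := exists_bound_unitDisc (((hpk 0).pow 2).add ((hpk 1).pow 2)).sqrt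
  have hQ : ∀ n, Integrable (fun y => Real.sqrt (wDens (χ n) y) ^ 2) (volume.restrict unitDisc) :=
    fun n => ((hχ n).integrableOn_wDens).congr_fun
      (fun y hy => (Real.sq_sqrt (wDens_nonneg _ hy)).symm) measurableSet_unitDisc
  have hQlim : Tendsto (fun n => ∫ y in unitDisc, Real.sqrt (wDens (χ n) y) ^ 2) atTop (𝓝 0) :=
    hcap.congr fun n => setIntegral_congr_fun measurableSet_unitDisc
      fun y hy => (Real.sq_sqrt (wDens_nonneg (χ n) hy)).symm
  set T₁ : ℕ → ℝ := fun n => ∫ y in unitDisc,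
    k y * (disc y * (pd 0 (χ n) y * pd 0 v y + pd 1 (χ n) y * pd 1 v y))
  set T₂ : ℕ → ℝ := fun n => ∫ y in unitDisc,
    v y * (disc y * (pd 0 (χ n) y * pd 0 k y + pd 1 (χ n) y * pd 1 k y))
  have hT₁ : Tendsto T₁ atTop (𝓝 0) := by
    refine tendsto_integral_zero_of_abs_le (P := fun y => C₁ * Real.sqrt (wDens v y))
      (Q := fun n y => Real.sqrt (wDens (χ n) y)) ?_ hQ (fun n => ?_) hQlim
    · refine IntegrableOn.congr_fun (f := fun y => C₁ ^ 2 * wDens v y)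
        ((hH.integrableOn_wDens hu).const_mul (C₁ ^ 2)) (fun y hy => ?_) measurableSet_unitDisc
      simp only [mul_pow]
      rw [Real.sq_sqrt (wDens_nonneg _ hy)]
    · filter_upwards [ae_restrict_mem measurableSet_unitDisc] with y hy
      rw [abs_mul, mul_assoc]
      exact mul_le_mul (hC₁ y hy) (sum_sq_pd_le hy) (abs_nonneg _) hC₁0
  -- The root of the weight turns `v` into `u`, so `(1 - |y|²)^{1/2} v |∇k| ≤ C₂ u`, which is square
  -- integrable.
  have hT₂ : Tendsto T₂ atTop (𝓝 0) := by
    refine tendsto_integral_zero_of_abs_le (P := fun y => C₂ * u y)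
      (Q := fun n y => Real.sqrt (wDens (χ n) y)) ?_ hQ (fun n => ?_) hQlim
    · refine (hH.1.integrable_sq.const_mul (C₂ ^ 2)).congr (.of_forall fun y => ?_)
      simp only [mul_pow]
    · filter_upwards [ae_restrict_mem measurableSet_unitDisc] with y hy
      rw [abs_mul]
      have hr := rootDisc_pos hy
      have hv0 : 0 ≤ v y := by
        have := hu0 y hy
        rw [eq_rootDisc_mul_divRoot u hy] at this
        exact nonneg_of_mul_nonneg_right this hr
      have hs : Real.sqrt (wDens k y) ≤ rootDisc y * C₂ := by
        rw [wDens, Real.sqrt_mul (mem_unitDisc.1 hy).le]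
        exact mul_le_mul_of_nonneg_left ((le_abs_self _).trans (hC₂ y hy)) hr.le
      rw [abs_of_nonneg hv0]
      calc _ ≤ v y * (Real.sqrt (wDens k y) * Real.sqrt (wDens (χ n) y)) :=
            mul_le_mul_of_nonneg_left (sum_sq_pd_le hy) hv0
        _ ≤ v y * (rootDisc y * C₂ * Real.sqrt (wDens (χ n) y)) := by gcongr
        _ = _ := by rw [eq_rootDisc_mul_divRoot u hy]; ring
  have hp : ∀ {w : Plane → ℝ}, ContDiffOn ℝ 1 w unitDisc → ∀ i,
      ContinuousOn (pd i w) unitDisc := fun hw i =>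
    (hw.pd (m := 0) isOpen_unitDisc (by norm_num) i).continuousOn
  have hdc : ContinuousOn disc unitDisc := (contDiff_disc (n := 0)).continuous.continuousOn
  have hGint : IntegrableOn (fun y => mollWeight ε x y * u y) unitDisc :=
    integrableOn_mul_of_continuousOn_closedBall hH.integrableOn (continuousOn_mollWeight hε hx)
  have hKint : IntegrableOn (fun y => rootDisc y * k y * f y) unitDisc :=
    integrableOn_mul_of_continuousOn_closedBall hf (continuous_rootDisc.continuousOn.mul hkc)
  have hGc : ContinuousOn (fun y => mollWeight ε x y * u y) unitDisc :=
    ((continuousOn_mollWeight hε hx).mono Metric.ball_subset_closedBall).mul hu.continuousOn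
  have hG0 : ∀ y ∈ unitDisc, 0 ≤ mollWeight ε x y * u y := fun y hy => by
    have := regDist_pos hε x y
    have := Real.pi_pos
    have := rootDisc_pos hy
    have := moebFactor_pos hx (norm_le_one_of_mem hy)
    have := hu0 y hy
    unfold mollWeight
    positivity
  -- The symmetric terms `∇k · ∇v` cancel. Positivity of `u` is what allows the kernel inequality to
  -- be multiplied by `v`; positivity of `k` and `f` removes `χ_n` from the source term.
  have hle : ∀ n, ∫ y in unitDisc, χ n y * (mollWeight ε x y * u y) ≤
      (∫ y in unitDisc, rootDisc y * k y * f y) - T₁ n + T₂ n := fun n => by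
    have e1 : T₁ n = _ := (hχ n).integral_mul_wDiv hk1 hv
    have e2 : T₂ n = _ := (hχ n).integral_mul_wDiv hv1 hk2
    have i1 : IntegrableOn (fun y => χ n y * (disc y * (pd 0 k y * pd 0 v y + pd 1 k y * pd 1 v y) +
        k y * wDiv v y)) unitDisc := (hχ n).integrableOn_mul ((hdc.mul (((hp hk1 0).mul (hp hv1 0)).add
      ((hp hk1 1).mul (hp hv1 1)))).add (hk1.continuousOn.mul (continuousOn_wDiv hv)))
    have i2 : IntegrableOn (fun y => χ n y * (disc y * (pd 0 v y * pd 0 k y + pd 1 v y * pd 1 k y) +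
        v y * wDiv k y)) unitDisc := (hχ n).integrableOn_mul ((hdc.mul (((hp hv1 0).mul (hp hk1 0)).add
      ((hp hv1 1).mul (hp hk1 1)))).add (hv1.continuousOn.mul (continuousOn_wDiv hk2)))
    have i3 := hKint.add i1
    simp only [Pi.add_def] at i3
    rw [e1, e2, sub_neg_eq_add, ← sub_eq_add_neg, ← integral_add hKint i1, ← integral_sub
      i3 i2]
    refine setIntegral_mono_on ((hχ n).integrableOn_mul hGc) (i3.sub i2)
      measurableSet_unitDisc fun y hy => ?_
    have hr := rootDisc_pos hy
    have hL := le_compKernel_sub_wDiv hε hx hεx hy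
    have hv0 : 0 ≤ v y := by
      have := hu0 y hy
      rw [eq_rootDisc_mul_divRoot u hy] at this
      exact nonneg_of_mul_nonneg_right this hr
    have hE : wDiv v y = v y - rootDisc y * f y := by
      rw [hvdef, wDiv_divRoot hu hy, hpde y hy]
    have hK0 : χ n y * (rootDisc y * k y * f y) ≤ rootDisc y * k y * f y :=
      mul_le_of_le_one_left (mul_nonneg (rootDisc_mul_compKernel_nonneg hε hx hεx hy)
        (hf0 y hy)) (h1 n y)
    have hM : mollWeight ε x y * u y = v y *
        (moebFactor x y * (disc y * ε ^ 2 / (Real.pi * regDist ε x y ^ 2))) := by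
      rw [mollWeight, eq_rootDisc_mul_divRoot u hy, ← rootDisc_sq hy]; ring
    have hM2 : χ n y * (mollWeight ε x y * u y) ≤ χ n y * (v y * (k y - wDiv k y)) := by
      rw [hM]
      exact mul_le_mul_of_nonneg_left (mul_le_mul_of_nonneg_left hL hv0) (h0 n y)
    rw [hE]
    linarith
  have hlim : Tendsto (fun n => (∫ y in unitDisc, rootDisc y * k y * f y) - T₁ n + T₂ n) atTop
      (𝓝 (∫ y in unitDisc, rootDisc y * k y * f y)) := by
    simpa using (tendsto_const_nhds.sub hT₁).add hT₂
  have hfin := lintegral_le_of_cutoff hχ h0 hone hGc hG0 hle hlim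
  rw [← ofReal_integral_eq_lintegral_ofReal hGint (by
    filter_upwards [ae_restrict_mem measurableSet_unitDisc] with y hy using hG0 y hy)] at hfin
  exact (ENNReal.ofReal_le_ofReal_iff (setIntegral_nonneg measurableSet_unitDisc fun y hy =>
    mul_nonneg (rootDisc_mul_compKernel_nonneg hε hx hεx hy) (hf0 y hy))).1 hfin

/-! ### The approximate identity. -/

theorem integral_planar_kernel :
    ∫ z : Plane, 1 / (Real.pi * (1 + ‖z‖ ^ 2) ^ 2) = 1 := by
  rw [integral_fun_norm_addHaar volume (fun r : ℝ => 1 / (Real.pi * (1 + r ^ 2) ^ 2))]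
  have hd : ∀ r ∈ Ici (0 : ℝ), HasDerivAt (fun r : ℝ => -(2 * Real.pi)⁻¹ * (1 + r ^ 2)⁻¹)
      (r * (1 / (Real.pi * (1 + r ^ 2) ^ 2))) r := fun r _ => by
    have hp : (1 + r ^ 2) ≠ 0 := by positivity
    refine ((((hasDerivAt_pow 2 r).const_add 1).inv hp).const_mul _).congr_deriv ?_
    have := Real.pi_pos
    field_simp; norm_num
  have hlim : Tendsto (fun r : ℝ => -(2 * Real.pi)⁻¹ * (1 + r ^ 2)⁻¹) atTop (𝓝 0) := by
    have : Tendsto (fun r : ℝ => (1 + r ^ 2)⁻¹) atTop (𝓝 0) :=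
      tendsto_inv_atTop_zero.comp (tendsto_atTop_add_const_left _ _ (tendsto_pow_atTop two_ne_zero))
    simpa using this.const_mul (-(2 * Real.pi)⁻¹)
  have h := integral_Ioi_of_hasDerivAt_of_nonneg' hd (fun r hr => by
    have : (0 : ℝ) < r := hr
    have := Real.pi_pos
    positivity) hlim
  simp only [finrank_euclideanSpace, Fintype.card_fin, Nat.add_one_sub_one, pow_one, smul_eq_mul]
  rw [h, Measure.real, EuclideanSpace.volume_ball_fin_two]
  have := Real.pi_pos
  simp [Real.pi_pos.le]

/-- With `c = 1/ε` the bump is the dilation `c² η(c(x - y))` of `η(z) = 1/(π(1 + |z|²)²)`, which has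
unit mass and satisfies `|z|² η(z) → 0` at infinity. -/
theorem tendsto_integral_mollWeight {u : Plane → ℝ} (hu : ContinuousOn u unitDisc)
    (hui : IntegrableOn u unitDisc) {x : Plane} (hx : x ∈ unitDisc) :
    Tendsto (fun c : ℝ => ∫ y in unitDisc, mollWeight c⁻¹ x y * u y) atTop (𝓝 (u x)) := by
  have hpi := Real.pi_pos
  set g : Plane → ℝ := unitDisc.indicator (fun y => rootDisc y * moebFactor x y * u y) with hg
  have hmc := continuous_rootDisc.continuousOn.mul (continuousOn_moebFactor hx)
  have hgi : Integrable g := (integrable_indicator_iff measurableSet_unitDisc).2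
    (integrableOn_mul_of_continuousOn_closedBall hui hmc)
  have hgc : ContinuousAt g x := by
    have h1 : ContinuousOn (fun y => rootDisc y * moebFactor x y * u y) unitDisc :=
      (hmc.mono Metric.ball_subset_closedBall).mul hu
    refine (h1.continuousAt (unitDisc_mem_nhds hx)).congr ?_
    filter_upwards [unitDisc_mem_nhds hx] with y hy
    rw [hg, indicator_of_mem hy]
  -- On the diagonal `moebDen x x = (1 - |x|²)²`, so the prefactor of `u` equals 1.
  have hgx : g x = u x := by
    have hr := rootDisc_pos hx
    have h1 : moebDen x x = (rootDisc x ^ 2) ^ 2 := by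
      rw [moebDen_eq, rootDisc_sq hx]; simp; ring
    rw [hg, indicator_of_mem hx, moebFactor, h1, Real.sqrt_sq (by positivity)]
    field_simp
  have hdecay : Tendsto (fun z : Plane => ‖z‖ ^ Module.finrank ℝ Plane *
      (1 / (Real.pi * (1 + ‖z‖ ^ 2) ^ 2))) (Bornology.cobounded Plane) (𝓝 0) := by
    have h1 : Tendsto (fun z : Plane => (‖z‖ ^ 2)⁻¹) (Bornology.cobounded Plane) (𝓝 0) :=
      tendsto_inv_atTop_zero.comp ((tendsto_pow_atTop two_ne_zero).comp
        tendsto_norm_cobounded_atTop)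
    refine squeeze_zero (fun z => by positivity) (fun z => ?_) h1
    rw [finrank_euclideanSpace, Fintype.card_fin]
    rcases eq_or_ne (‖z‖ ^ 2) 0 with h | h
    · simp [h]
    · have h0 : 0 < ‖z‖ ^ 2 := lt_of_le_of_ne (sq_nonneg _) (Ne.symm h)
      rw [mul_one_div, div_le_iff₀ (by positivity), inv_mul_eq_div, le_div_iff₀ h0]
      nlinarith [Real.pi_gt_three, mul_pos h0 h0]
  have key := tendsto_integral_comp_smul_smul_of_integrable' (μ := volume)
    (φ := fun z : Plane => 1 / (Real.pi * (1 + ‖z‖ ^ 2) ^ 2)) (fun z => by positivity)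
    integral_planar_kernel hdecay hgi hgc
  rw [hgx] at key
  refine key.congr' ?_
  filter_upwards [eventually_gt_atTop 0] with c hc
  rw [← integral_indicator measurableSet_unitDisc]
  congr 1; ext y
  by_cases hy : y ∈ unitDisc
  · rw [hg, indicator_of_mem hy, indicator_of_mem hy, mollWeight, regDist_eq,
      finrank_euclideanSpace, Fintype.card_fin, norm_smul, Real.norm_of_nonneg hc.le, smul_eq_mul]
    have h1 : 0 < 1 + (c * ‖x - y‖) ^ 2 := by positivity
    have h2 : ‖x - y‖ ^ 2 + c⁻¹ ^ 2 = (1 + (c * ‖x - y‖) ^ 2) / c ^ 2 := by field_simp; ring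
    rw [h2]
    field_simp
  · rw [hg, indicator_of_notMem hy, indicator_of_notMem hy, smul_zero]

/-! ### Jensen's inequality and exponential integrability. -/

/-- The majorant of the exponentiated kernel. -/
noncomputable def expLogKernel (α r : ℝ) : ℝ :=
  Real.exp (α + α / (2 * Real.pi) * (Real.log 2 - Real.log r))

theorem expLogKernel_pos (α r : ℝ) : 0 < expLogKernel α r := Real.exp_pos _

theorem measurable_expLogKernel (α : ℝ) : Measurable (expLogKernel α) := by
  unfold expLogKernel; fun_prop

/-- In polar coordinates the integrand is a constant times `r^{1 - β}` with `β = α/(2π)`, and `1 - β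
> -1` is the condition `α < 4π`. -/
theorem integrableOn_expLogKernel {α : ℝ} (hα : α < 4 * Real.pi) :
    IntegrableOn (fun z : Plane => expLogKernel α ‖z‖) (Metric.ball 0 2) := by
  rw [integrableOn_fun_norm_addHaar]
  simp only [finrank_euclideanSpace, Fintype.card_fin, Nat.add_one_sub_one, pow_one, smul_eq_mul]
  set β := α / (2 * Real.pi) with hβ
  have hβ2 : β < 2 := by
    rw [hβ, div_lt_iff₀ (by positivity)]; linarith
  have h1 : IntegrableOn (fun r : ℝ => Real.exp (α + β * Real.log 2) * r ^ (1 - β)) (Ioo 0 2) := by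
    refine Integrable.const_mul ?_ _
    exact (intervalIntegral.integrableOn_Ioo_rpow_iff (by norm_num)).2 (by linarith)
  refine h1.congr_fun (fun r hr => ?_) measurableSet_Ioo
  have hr0 : 0 < r := hr.1
  simp only [expLogKernel]
  rw [Real.rpow_def_of_pos hr0]
  nth_rewrite 2 [← Real.exp_log hr0]
  rw [← Real.exp_add, ← Real.exp_add]
  congr 1
  rw [hβ]; ring

/-- Jensen's inequality for the exponential against a density. -/
theorem exp_integral_le {μ : Measure Plane} {f K : Plane → ℝ} {a m : ℝ} (hm : 0 < m)
    (hf0 : ∀ᵐ y ∂μ, 0 ≤ f y) (hfm : ∫ y, f y ∂μ = m) (hf : Integrable f μ)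
    (hK : Integrable (fun y => K y * f y) μ)
    (hE : Integrable (fun y => Real.exp (a * K y) * f y) μ) :
    Real.exp (a * (∫ y, K y * f y ∂μ) / m) ≤ (∫ y, Real.exp (a * K y) * f y ∂μ) / m := by
  set s := a * (∫ y, K y * f y ∂μ) / m with hs
  rw [le_div_iff₀ hm]
  -- The tangent line of `exp` at the mean `s`: `exp t ≥ exp s (1 + t - s)` at `t = a K y`,
  -- integrated against `f`.
  have hi : Integrable (fun y => Real.exp s * (a * (K y * f y) + (1 - s) * f y)) μ :=
    ((hK.const_mul a).add (hf.const_mul (1 - s))).const_mul _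
  calc Real.exp s * m = ∫ y, Real.exp s * (a * (K y * f y) + (1 - s) * f y) ∂μ := by
        rw [integral_const_mul, integral_add (hK.const_mul a) (hf.const_mul (1 - s)),
          integral_const_mul, integral_const_mul, hfm]
        have : a * ∫ y, K y * f y ∂μ = s * m := by rw [hs]; field_simp
        rw [this]; ring
    _ ≤ _ := by
        refine integral_mono_ae hi hE ?_
        filter_upwards [hf0] with y hy
        have h1 := Real.add_one_le_exp (a * K y - s)
        have h2 : Real.exp (a * K y) = Real.exp s * Real.exp (a * K y - s) := by
          rw [← Real.exp_add]; congr 1; ring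
        rw [h2]
        have h3 := mul_le_mul_of_nonneg_left h1 (mul_nonneg (Real.exp_pos s).le hy)
        linarith

/-- Jensen is applied at fixed `ε`. The kernel majorant does not depend on `ε`, so only the left
side is passed to the limit. -/
theorem ofReal_exp_le_lintegral {u f : Plane → ℝ} (hu : ContDiffOn ℝ 2 u unitDisc)
    (hH : MemHardySpace u)
    (hpde : ∀ x ∈ unitDisc, -(Δ u x) - 1 / (1 - ‖x‖ ^ 2) ^ 2 * u x = f x)
    (hf0 : ∀ x ∈ unitDisc, 0 ≤ f x) (hf : IntegrableOn f unitDisc)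
    {m : ℝ} (hm : 0 < m) (hfm : ∫ y in unitDisc, f y = m) {α : ℝ} (hα : 0 ≤ α)
    {x : Plane} (hx : x ∈ unitDisc) :
    ENNReal.ofReal (Real.exp (α * u x / m)) ≤
      ∫⁻ y in unitDisc, ENNReal.ofReal (f y / m) * ENNReal.ofReal (expLogKernel α ‖x - y‖) := by
  have hlim : Tendsto (fun c : ℝ => ENNReal.ofReal (Real.exp
      (α * (∫ y in unitDisc, mollWeight c⁻¹ x y * u y) / m))) atTop
      (𝓝 (ENNReal.ofReal (Real.exp (α * u x / m)))) :=
    ENNReal.tendsto_ofReal ((Real.continuous_exp.tendsto _).comp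
      (((tendsto_integral_mollWeight hu.continuousOn hH.integrableOn hx).const_mul α).div_const m))
  refine le_of_tendsto hlim ?_
  have hb := mem_unitDisc.1 hx
  -- This range of `c` ensures `ε = c⁻¹ ≤ 1 - |x|²`, as the kernel bounds require.
  filter_upwards [eventually_ge_atTop (disc x)⁻¹] with c hc
  have hc0 : 0 < c := (inv_pos.2 hb).trans_le hc
  set ε := c⁻¹ with hε'
  have hε : 0 < ε := inv_pos.2 hc0
  have hεx : ε ≤ disc x := inv_le_of_inv_le₀ hb hc
  have hpi := Real.pi_pos
  have hkc : ContinuousOn (fun y => rootDisc y * compKernel ε x y) (Metric.closedBall 0 1) :=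
    continuous_rootDisc.continuousOn.mul ((contDiffOn_compKernel hε x (n := 0)).continuousOn.mono
      (closedBall_subset_moebDen_pos hx))
  have hf0' : ∀ᵐ y ∂(volume.restrict unitDisc), 0 ≤ f y := by
    filter_upwards [ae_restrict_mem measurableSet_unitDisc] with y hy using hf0 y hy
  have hE : IntegrableOn (fun y => Real.exp (α * (rootDisc y * compKernel ε x y)) * f y)
      unitDisc := integrableOn_mul_of_continuousOn_closedBall hf
        (Real.continuous_exp.comp_continuousOn (continuousOn_const.mul hkc))
  have hJ := exp_integral_le (a := α) hm hf0' hfm hf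
    (integrableOn_mul_of_continuousOn_closedBall hf hkc) hE
  have hmono : Real.exp (α * (∫ y in unitDisc, mollWeight ε x y * u y) / m) ≤
      Real.exp (α * (∫ y in unitDisc, rootDisc y * compKernel ε x y * f y) / m) :=
    Real.exp_le_exp.2 (div_le_div_of_nonneg_right (mul_le_mul_of_nonneg_left
      (integral_mollWeight_le hu hH hpde hf0 hf hx hε hεx) hα) hm.le)
  refine (ENNReal.ofReal_le_ofReal (hmono.trans hJ)).trans ?_
  rw [← integral_div, ofReal_integral_eq_lintegral_ofReal (hE.div_const m) (by
    filter_upwards [hf0'] with y hy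
    exact div_nonneg (mul_nonneg (Real.exp_pos _).le hy) hm.le)]
  refine lintegral_mono_ae ?_
  have hne : ∀ᵐ y ∂(volume.restrict unitDisc), y ≠ x :=
    ae_restrict_of_ae (compl_mem_ae_iff.2 (measure_singleton x))
  filter_upwards [ae_restrict_mem measurableSet_unitDisc, hne] with y hy hyx
  rw [← ENNReal.ofReal_mul (div_nonneg (hf0 y hy) hm.le)]
  apply ENNReal.ofReal_le_ofReal
  have hr : 0 < ‖x - y‖ := norm_pos_iff.2 (sub_ne_zero.2 (Ne.symm hyx))
  have hk : Real.exp (α * (rootDisc y * compKernel ε x y)) ≤ expLogKernel α ‖x - y‖ := by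
    unfold expLogKernel
    apply Real.exp_le_exp.2
    have h1 := rootDisc_mul_compKernel_le hε hx hεx hy
    have h2 : 2 * Real.log ‖x - y‖ ≤ Real.log (regDist ε x y) := by
      rw [← Real.log_rpow hr]
      apply Real.log_le_log (by positivity)
      rw [regDist_eq, Real.rpow_two]
      nlinarith
    have h3 : Real.log 4 = 2 * Real.log 2 := by
      rw [show (4 : ℝ) = 2 ^ 2 by norm_num, Real.log_pow]; norm_num
    have h4 : (Real.log 4 - Real.log (regDist ε x y)) / (4 * Real.pi) ≤
        (2 * Real.log 2 - 2 * Real.log ‖x - y‖) / (4 * Real.pi) := by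
      rw [h3]; gcongr
    calc _ ≤ α * (1 + (2 * Real.log 2 - 2 * Real.log ‖x - y‖) / (4 * Real.pi)) :=
          mul_le_mul_of_nonneg_left (h1.trans (by linarith)) hα
      _ = _ := by field_simp; ring
  calc _ = f y / m * Real.exp (α * (rootDisc y * compKernel ε x y)) := by ring
    _ ≤ _ := mul_le_mul_of_nonneg_left hk (div_nonneg (hf0 y hy) hm.le)

/-- Tonelli: `f/m` has mass 1, and for each `y` in the disc the translate `x - y` stays in the disc
of radius 2. Hence the bound depends on `α` alone. -/
theorem lintegral_exp_le {u f : Plane → ℝ} (hu : ContDiffOn ℝ 2 u unitDisc)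
    (hH : MemHardySpace u)
    (hpde : ∀ x ∈ unitDisc, -(Δ u x) - 1 / (1 - ‖x‖ ^ 2) ^ 2 * u x = f x)
    (hf0 : ∀ x ∈ unitDisc, 0 ≤ f x) (hf : IntegrableOn f unitDisc)
    {m : ℝ} (hm : 0 < m) (hfm : ∫ y in unitDisc, f y = m) {α : ℝ} (hα : 0 ≤ α)
    (hα4 : α < 4 * Real.pi) :
    ∫⁻ x in unitDisc, ENNReal.ofReal (Real.exp (α * u x / m)) ≤
      ENNReal.ofReal (∫ z in Metric.ball (0 : Plane) 2, expLogKernel α ‖z‖) := by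
  set Φ : Plane → ENNReal := fun z => ENNReal.ofReal (expLogKernel α ‖z‖) with hΦ
  have hΦm : Measurable Φ := ((measurable_expLogKernel α).comp measurable_norm).ennreal_ofReal
  have hmass : ∫⁻ y in unitDisc, ENNReal.ofReal (f y / m) = 1 := by
    rw [← ofReal_integral_eq_lintegral_ofReal (hf.div_const m), integral_div, hfm, div_self hm.ne',
      ENNReal.ofReal_one]
    filter_upwards [ae_restrict_mem measurableSet_unitDisc] with y hy
    exact div_nonneg (hf0 y hy) hm.le
  have hinner : ∀ y ∈ unitDisc, ∫⁻ x in unitDisc, Φ (x - y) ≤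
      ∫⁻ z in Metric.ball (0 : Plane) 2, Φ z := fun y hy => by
    rw [← lintegral_indicator measurableSet_unitDisc,
      ← lintegral_indicator Metric.isOpen_ball.measurableSet,
      ← lintegral_sub_right_eq_self ((Metric.ball (0 : Plane) 2).indicator Φ) y]
    refine lintegral_mono fun x => ?_
    by_cases hx : x ∈ unitDisc
    · have : x - y ∈ Metric.ball (0 : Plane) 2 := by
        rw [mem_ball_zero_iff]
        have h1 : ‖x‖ < 1 := mem_ball_zero_iff.1 hx
        have h2 : ‖y‖ < 1 := mem_ball_zero_iff.1 hy
        linarith [norm_sub_le x y]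
      rw [indicator_of_mem hx, indicator_of_mem this]
    · rw [indicator_of_notMem hx]; exact zero_le
  have hfa : AEMeasurable (fun y => ENNReal.ofReal (f y / m)) (volume.restrict unitDisc) :=
    (hf.div_const m).aemeasurable.ennreal_ofReal
  calc _ ≤ ∫⁻ x in unitDisc, ∫⁻ y in unitDisc, ENNReal.ofReal (f y / m) * Φ (x - y) :=
        setLIntegral_mono_ae' measurableSet_unitDisc (.of_forall fun x hx =>
          ofReal_exp_le_lintegral hu hH hpde hf0 hf hm hfm hα hx)
    _ = ∫⁻ y in unitDisc, ∫⁻ x in unitDisc, ENNReal.ofReal (f y / m) * Φ (x - y) := by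
        refine lintegral_lintegral_swap ?_
        exact (hfa.comp_snd).mul (hΦm.comp (measurable_fst.sub measurable_snd)).aemeasurable
    _ = ∫⁻ y in unitDisc, ENNReal.ofReal (f y / m) * ∫⁻ x in unitDisc, Φ (x - y) := by
        congr 1; ext y
        exact lintegral_const_mul _ (hΦm.comp (measurable_id.sub_const y))
    _ ≤ ∫⁻ y in unitDisc, ENNReal.ofReal (f y / m) * ∫⁻ z in Metric.ball (0 : Plane) 2, Φ z :=
        setLIntegral_mono_ae' measurableSet_unitDisc (.of_forall fun y hy =>
          mul_le_mul' le_rfl (hinner y hy))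
    _ = ∫⁻ z in Metric.ball (0 : Plane) 2, Φ z := by
        rw [lintegral_mul_const'' _ hfa, hmass, one_mul]
    _ = _ := (ofReal_integral_eq_lintegral_ofReal (integrableOn_expLogKernel hα4)
        (.of_forall fun z => (expLogKernel_pos α _).le)).symm

theorem lemma3p3 (δ : ℝ) (hδ : δ ∈ Set.Ioo 0 (4 * Real.pi)) :
    ∃ C : ℝ, ∀ u f : Plane → ℝ,
      ContDiffOn ℝ 2 u unitDisc →
      -- the boundary condition `u = 0` on `∂B₁`, in the sense of the energy space
      MemHardySpace u →
      (∀ x ∈ unitDisc, -(Δ u x) - 1 / (1 - ‖x‖ ^ 2) ^ 2 * u x = f x) →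
      (∀ x ∈ unitDisc, 0 ≤ f x) →
      IntegrableOn f unitDisc volume →
      0 < ∫ x in unitDisc, ‖f x‖ →
      IntegrableOn
          (fun x => Real.exp ((4 * Real.pi - δ) * |u x| / ∫ y in unitDisc, ‖f y‖))
          unitDisc volume ∧
        ∫ x in unitDisc, Real.exp ((4 * Real.pi - δ) * |u x| / ∫ y in unitDisc, ‖f y‖) ≤ C := by
  refine ⟨∫ z in Metric.ball (0 : Plane) 2, expLogKernel (4 * Real.pi - δ) ‖z‖, ?_⟩
  intro u f hu hH hpde hf0 hf hm
  set m := ∫ x in unitDisc, ‖f x‖ with hmdef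
  have hfm : ∫ y in unitDisc, f y = m := setIntegral_congr_fun measurableSet_unitDisc
    fun y hy => (Real.norm_of_nonneg (hf0 y hy)).symm
  have hu0 := hH.nonneg hu (fun z hz => (hpde z hz).symm ▸ hf0 z hz)
  have hle := lintegral_exp_le hu hH hpde hf0 hf hm hfm (α := 4 * Real.pi - δ)
    (by linarith [hδ.2]) (by linarith [hδ.1])
  have heq : ∫⁻ x in unitDisc, ENNReal.ofReal (Real.exp ((4 * Real.pi - δ) * |u x| / m)) =
      ∫⁻ x in unitDisc, ENNReal.ofReal (Real.exp ((4 * Real.pi - δ) * u x / m)) :=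
    setLIntegral_congr_fun measurableSet_unitDisc fun x hx => by
      simp only [abs_of_nonneg (hu0 x hx)]
  rw [← heq] at hle
  have hmeas : AEStronglyMeasurable (fun x => Real.exp ((4 * Real.pi - δ) * |u x| / m))
      (volume.restrict unitDisc) :=
    (Real.continuous_exp.comp_continuousOn ((continuousOn_const.mul
      hu.continuousOn.abs).div_const m)).aestronglyMeasurable measurableSet_unitDisc
  have hpos : 0 ≤ᵐ[volume.restrict unitDisc]
      fun x => Real.exp ((4 * Real.pi - δ) * |u x| / m) :=
    .of_forall fun x => (Real.exp_pos _).le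
  refine ⟨⟨hmeas, ?_⟩, ?_⟩
  · rw [hasFiniteIntegral_iff_ofReal hpos]
    exact hle.trans_lt ENNReal.ofReal_lt_top
  · rw [integral_eq_lintegral_of_nonneg_ae hpos hmeas]
    exact ENNReal.toReal_le_of_le_ofReal
      (integral_nonneg fun z => (expLogKernel_pos _ _).le) hle
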